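/- **Definitions.** For a monoid $R$ let $E(R)$ be its set of idempotents and $G(R)$ its unit group; $G(R)$ acts on $E(R)$ by conjugation. $R$ is *factorisable* if $R=E(R)G(R)=G(R)E(R)$ and the idempotents of $R$ commute; then $E(R)$ is a semi-lattice, ordered by $e\le f\iff ef=fe=e$. For $e\in E(R)$ put $$W(e)=\{w\in G(R)\mid we=ew\},\qquad W_\star(e)=\{w\in G(R)\mid we=ew=e\}.$$ A *generalised Renner–Coxeter system* is a triple $(R,\Lambda,S)$, where $R$ is a monoid, $\Lambda\subseteq E(R)$ and $S\subseteq G(R)$, such that 1. $R$ is factorisable; 2. $\Lambda$ contains exactly one element of each $G(R)$-orbit in $E(R)$, and is closed under multiplication; 3. $(G(R),S)$ is a Coxeter system; 4. for all $e_1\le e_2$ in $E(R)$ there are $w\in G(R)$ and $f_1\le f_2$ in $\Lambda$ with $wf_iw^{-1}=e_i$ for $i=1,2$; 5. for every $e\in\Lambda$ the subgroups $W(e)$ and $W_\star(e)$ are generated by subsets of $S$; 6. if $e\le f$ in $\Lambda$, then $\lambda^\star(e)\subseteq\lambda^\star(f)$, where $\lambda^\star(e)=\{s\in S\mid se=es\ne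 e\}$. Put $\Lambda_\circ=\Lambda\setminus\{1\}$. For $r\in R$ the *length* $\ell(r)$ is the minimum, over all words on $S\cup\Lambda_\circ$ that represent $r$, of the number of letters of the word that lie in $S$. One has $\ell(er)\le\ell(r)$ for $e\in\Lambda_\circ$. **Theorem.** Let $(R,\Lambda,S)$ be a generalised Renner–Coxeter system, let $A$ be a unital associative ring and let $q$ be a central element of $A$ (any element, if $A$ is commutative). Let $V$ be the free $A$-module with basis $(T_r)_{r\in R}$. There is a unique structure of unital associative $A$-algebra on $V$ such that $T_1$ is the unit and, for all $r\in R$, $s\in S$ and $e\in\Lambda_\circ$, $$T_sT_r=\begin{cases}T_{sr}&\text{if }\ell(sr)=\ell(r)+1,\\ qT_r&\text{if }\ell(sr)=\ell(r),\\ (q-1)T_r+qT_{sr}&\text{if }\ell(sr)=\ell(r)-1,\end{cases}\qquad T_eT_r=q^{\ell(r)-\ell(er)}T_{er}.$$ Here, if $A$ is not commutative, $V$ is regarded as an $A$-bimodule through $(bT_r)a=(ba)T_r$, and an $A$-algebra structure on $V$ means a biadditive associative unital product with $(ax)y=a(xy)$, $(xa)y=x(ay)$ and $(xy)a=x(ya)$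 for all $a\in A$ and $x,y\in V$; if $A$ is commutative, this is an $A$-algebra structure in the usual sense. In particular, for $A=\mathbb Z[q]$ with $q$ an indeterminate, there is a unique such structure; the resulting $\mathbb Z[q]$-algebra is the *generic Hecke algebra* $\mathcal H(R)$. -/

import Mathlib

namespace RennerCoxeter

section System

variable {R : Type*} [Monoid R]

/-- A monoid `R` is factorisable if `R = E(R) G(R) = G(R) E(R)`, where `E(R)` is the set of
idempotents and `G(R) = Rˣ` the unit group, and if idempotents commute
(so that `E(R)` is a semi-lattice). -/
structure IsFactorisable (R : Type*) [Monoid R] : Prop where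
  eq_idem_mul_unit : ∀ r : R, ∃ (e : R) (u : Rˣ), IsIdempotentElem e ∧ r = e * u
  eq_unit_mul_idem : ∀ r : R, ∃ (u : Rˣ) (e : R), IsIdempotentElem e ∧ r = u * e
  idem_comm : ∀ e f : R, IsIdempotentElem e → IsIdempotentElem f → e * f = f * e

/-- The order of the semi-lattice of idempotents: `e ≤ f` if and only if `ef = fe = e`. -/
def IdemLE (e f : R) : Prop := e * f = e ∧ f * e = e

/-- The action of the unit group by conjugation: `w e w⁻¹`. -/
def conj (w : Rˣ) (e : R) : R := (w : R) * e * ((w⁻¹ : Rˣ) : R)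

/-- `W(e) = {w ∈ G(R) ∣ we = ew}`. -/
def centralizer (e : R) : Subgroup Rˣ where
  carrier := {w | (w : R) * e = e * w}
  one_mem' := by simp
  mul_mem' := by
    intro a b ha hb
    simp only [Set.mem_ofPred_eq, Units.val_mul] at *
    rw [mul_assoc, hb, ← mul_assoc, ha, mul_assoc]
  inv_mem' := by
    intro a ha
    simp only [Set.mem_ofPred_eq] at *
    rw [Units.inv_mul_eq_iff_eq_mul, ← mul_assoc, Units.eq_mul_inv_iff_mul_eq, ha]

/-- `W_⋆(e) = {w ∈ G(R) ∣ we = ew = e}`. -/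
def fixer (e : R) : Subgroup Rˣ where
  carrier := {w | (w : R) * e = e ∧ e * w = e}
  one_mem' := by simp
  mul_mem' := by
    rintro a b ⟨ha, ha'⟩ ⟨hb, hb'⟩
    refine ⟨?_, ?_⟩
    · rw [Units.val_mul, mul_assoc, hb, ha]
    · rw [Units.val_mul, ← mul_assoc, ha', hb']
  inv_mem' := by
    rintro a ⟨ha, ha'⟩
    exact ⟨by rw [Units.inv_mul_eq_iff_eq_mul, ha], by rw [Units.mul_inv_eq_iff_eq_mul, ha']⟩

/-- `λ^⋆(e) = {s ∈ S ∣ se = es ≠ e}`. -/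
def upperType (S : Set Rˣ) (e : R) : Set Rˣ :=
  {s | s ∈ S ∧ (s : R) * e = e * s ∧ e * s ≠ e}

/-- `(W, S)` is a Coxeter system, for a subset `S` of the group `W`. -/
def IsCoxeterPair {W : Type*} [Group W] (S : Set W) : Prop :=
  ∃ (M : CoxeterMatrix S) (cs : CoxeterSystem M W), ∀ s : S, cs.simple s = s

/-- The subgroup `H` is a standard parabolic subgroup `W_I`, `I ⊆ S`, of `W`. -/
def IsStandardParabolic {W : Type*} [Group W] (S : Set W) (H : Subgroup W) : Prop :=
  ∃ I : Set W, I ⊆ S ∧ H = Subgroup.closure I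

/-- Generalised Renner--Coxeter systems `(R, Λ, S)`. -/
structure IsSystem (Λ : Set R) (S : Set Rˣ) : Prop where
  factorisable : IsFactorisable R
  idem_of_mem : ∀ e ∈ Λ, IsIdempotentElem e
  transversal : ∀ e : R, IsIdempotentElem e → ∃! f : R, f ∈ Λ ∧ ∃ w : Rˣ, conj w e = f
  mul_mem : ∀ e ∈ Λ, ∀ f ∈ Λ, e * f ∈ Λ
  coxeter : IsCoxeterPair S
  conj_pair : ∀ e₁ e₂ : R, IsIdempotentElem e₁ → IsIdempotentElem e₂ → IdemLE e₁ e₂ →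
    ∃ (w : Rˣ) (f₁ f₂ : R), f₁ ∈ Λ ∧ f₂ ∈ Λ ∧ IdemLE f₁ f₂ ∧ conj w f₁ = e₁ ∧ conj w f₂ = e₂
  parabolic_centralizer : ∀ e ∈ Λ, IsStandardParabolic S (centralizer e)
  parabolic_fixer : ∀ e ∈ Λ, IsStandardParabolic S (fixer e)
  upperType_mono : ∀ e ∈ Λ, ∀ f ∈ Λ, IdemLE e f → upperType S e ⊆ upperType S f

/-- The alphabet `S ∪ Λ∘` with `Λ∘ = Λ \ {1}`. -/
abbrev Letter (Λ : Set R) (S : Set Rˣ) : Type _ := S ⊕ (Λ \ {1} : Set R)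

/-- The element of `R` given by a letter. -/
def Letter.val {Λ : Set R} {S : Set Rˣ} : Letter Λ S → R
  | Sum.inl s => ((s : Rˣ) : R)
  | Sum.inr e => (e : R)

/-- Letters in `S` have length `1`, letters in `Λ∘` have length `0`. -/
def Letter.len {Λ : Set R} {S : Set Rˣ} : Letter Λ S → ℕ
  | Sum.inl _ => 1
  | Sum.inr _ => 0

/-- The element of `R` represented by a word. -/
def wordVal {Λ : Set R} {S : Set Rˣ} (ω : List (Letter Λ S)) : R := (ω.map Letter.val).prod

/-- The length of a word. -/
def wordLen {Λ : Set R} {S : Set Rˣ} (ω : List (Letter Λ S)) : ℕ := (ω.map Letter.len).sum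

/-- The length `ℓ(r)`: the minimal length of a word over `S ∪ Λ∘` representing `r`. -/
noncomputable def length (Λ : Set R) (S : Set Rˣ) (r : R) : ℕ :=
  sInf {n | ∃ ω : List (Letter Λ S), wordVal ω = r ∧ wordLen ω = n}

/-- In a generalised Renner--Coxeter system every element is represented by a word, so the
minimum defining the length is taken over a nonempty set. -/
theorem IsSystem.exists_word {Λ : Set R} {S : Set Rˣ} (h : IsSystem Λ S) (r : R) :
    ∃ ω : List (Letter Λ S), wordVal ω = r := by
  have happ : ∀ a b : List (Letter Λ S), wordVal (a ++ b) = wordVal a * wordVal b := by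
    intro a b; simp [wordVal]
  have hu : ∀ u : Rˣ, ∃ ω : List (Letter Λ S), wordVal ω = (u : R) := by
    obtain ⟨M, cs, hcs⟩ := h.coxeter
    intro u
    obtain ⟨l, rfl⟩ := cs.wordProd_surjective u
    induction l with
    | nil => exact ⟨[], by simp [wordVal]⟩
    | cons s l ih =>
      obtain ⟨ω, hω⟩ := ih
      refine ⟨[Sum.inl s] ++ ω, ?_⟩
      rw [happ, hω, cs.wordProd_cons, hcs]
      simp [wordVal, Letter.val]
  have hΛ : ∀ e ∈ Λ, ∃ ω : List (Letter Λ S), wordVal ω = e := by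
    intro e he
    by_cases h1 : e = 1
    · exact ⟨[], by simp [wordVal, h1]⟩
    · exact ⟨[Sum.inr ⟨e, he, h1⟩], by simp [wordVal, Letter.val]⟩
  obtain ⟨e, u, he, rfl⟩ := h.factorisable.eq_idem_mul_unit r
  obtain ⟨f, ⟨hf, w, hw⟩, -⟩ := h.transversal e he
  obtain ⟨a, ha⟩ := hu w⁻¹
  obtain ⟨b, hb⟩ := hΛ f hf
  obtain ⟨c, hc⟩ := hu (w * u)
  refine ⟨a ++ b ++ c, ?_⟩
  rw [happ, happ, ha, hb, hc, ← hw, conj]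
  simp [mul_assoc]

/-- Left multiplication by an element of `Λ∘` does not increase the length. -/
theorem IsSystem.length_mul_le {Λ : Set R} {S : Set Rˣ} (h : IsSystem Λ S) {e : R}
    (he : e ∈ Λ \ {1}) (r : R) : length Λ S (e * r) ≤ length Λ S r := by
  obtain ⟨ω₀, h₀⟩ := h.exists_word r
  have hne : {n | ∃ ω : List (Letter Λ S), wordVal ω = r ∧ wordLen ω = n}.Nonempty :=
    ⟨_, ω₀, h₀, rfl⟩
  obtain ⟨ω, hω, hl⟩ := Nat.sInf_mem hne
  refine Nat.sInf_le ⟨Sum.inr ⟨e, he⟩ :: ω, ?_, ?_⟩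
  · rw [← hω]; simp [wordVal, Letter.val]
  · rw [length, ← hl]; simp [wordLen, Letter.len]

end System

section Hecke

variable {R : Type*} {A : Type*} [Ring A]

/-- The basis element `T_r` of the free `A`-module on `R`. -/
noncomputable def T (A : Type*) [Ring A] {R : Type*} (r : R) : R →₀ A := Finsupp.single r 1

/-- A biadditive product on the free `A`-module `V` on `R` makes `V` a unital associative
`A`-algebra with unit `one`. Here `V` carries its natural bimodule structure, in which
`(b T_r) a = (b a) T_r`; the right action of `a` on `x` is written `MulOpposite.op a • x`.
If `A` is commutative, then `x a = a x`, and one gets precisely the unital associative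
`A`-algebra structures in the usual sense, see `isAlgebraMul_iff`. -/
structure IsAlgebraMul (one : R →₀ A) (mul : (R →₀ A) →+ (R →₀ A) →+ (R →₀ A)) : Prop where
  one_mul : ∀ x, mul one x = x
  mul_one : ∀ x, mul x one = x
  mul_assoc : ∀ x y z, mul (mul x y) z = mul x (mul y z)
  smul_mul : ∀ (a : A) (x y), mul (a • x) y = a • mul x y
  smul_middle : ∀ (a : A) (x y), mul (MulOpposite.op a • x) y = mul x (a • y)
  mul_smul : ∀ (a : A) (x y), mul x (MulOpposite.op a • y) = MulOpposite.op a • mul x y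

/-- Over a commutative ring: a bilinear associative product with unit `one`. -/
theorem isAlgebraMul_iff {A : Type*} [CommRing A] (one : R →₀ A)
    (mul : (R →₀ A) →+ (R →₀ A) →+ (R →₀ A)) :
    IsAlgebraMul one mul ↔
      (∀ x, mul one x = x) ∧ (∀ x, mul x one = x) ∧
      (∀ x y z, mul (mul x y) z = mul x (mul y z)) ∧
      (∀ (a : A) (x y), mul (a • x) y = a • mul x y) ∧
      (∀ (a : A) (x y), mul x (a • y) = a • mul x y) := by
  constructor
  · intro h
    refine ⟨h.one_mul, h.mul_one, h.mul_assoc, h.smul_mul, fun a x y => ?_⟩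
    simpa only [op_smul_eq_smul] using h.mul_smul a x y
  · rintro ⟨h1, h2, h3, h4, h5⟩
    exact ⟨h1, h2, h3, h4, fun a x y => by rw [op_smul_eq_smul, h4, h5],
      fun a x y => by rw [op_smul_eq_smul, op_smul_eq_smul, h5]⟩

/-- The product `mul` is a unital associative `A`-algebra structure on the free `A`-module with
basis `(T_r)`, with unit `T_1`, in which left multiplication by the `T_x`, `x ∈ S ∪ Λ∘`, is given
by the Hecke rules with parameter `q`. In a generalised Renner--Coxeter system the exponent in
the last rule is not truncated, see `IsSystem.length_mul_le`. -/
structure IsHeckeMul [Monoid R] (Λ : Set R) (S : Set Rˣ) (q : A)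
    (mul : (R →₀ A) →+ (R →₀ A) →+ (R →₀ A)) : Prop where
  isAlgebraMul : IsAlgebraMul (T A (1 : R)) mul
  simple_of_gt : ∀ s ∈ S, ∀ r : R, length Λ S (s * r) = length Λ S r + 1 →
    mul (T A (s : R)) (T A r) = T A ((s : R) * r)
  simple_of_eq : ∀ s ∈ S, ∀ r : R, length Λ S (s * r) = length Λ S r →
    mul (T A (s : R)) (T A r) = q • T A r
  simple_of_lt : ∀ s ∈ S, ∀ r : R, length Λ S (s * r) + 1 = length Λ S r →
    mul (T A (s : R)) (T A r) = (q - 1) • T A r + q • T A ((s : R) * r)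
  idem : ∀ e ∈ Λ \ {1}, ∀ r : R,
    mul (T A e) (T A r) = q ^ (length Λ S r - length Λ S (e * r)) • T A (e * r)

end Hecke

end RennerCoxeter

/-!
Every element of `R` has a unique normal form `w₁ e w₂`, where `e ∈ Λ`, the unit `w₁` is shortest
in `w₁ W_⋆(e)` and `w₂` is shortest in `W(e) w₂`, and its length is `ℓ(w₁) + ℓ(w₂)`.

The prescribed formulas define operators `L_x` on `V` for the letters `x ∈ S ∪ Λ∘`. Conjugation by
the anti-automorphism `r ↦ r⁻¹` of the inverse monoid `R` turns them into operators `R_x` given by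
the mirrored formulas. A product of operators `L_x` along a word of minimal length representing `r`
maps `T_1` to `T_r`, and likewise for `R_x`. So a product on `V` with the prescribed values is
given by the `L_x`, which proves uniqueness, and the product obtained in this way is associative as
soon as every `L_x` commutes with every `R_y`.

The commutation is a matter of lengths. By the exchange property, multiplication by `s ∈ S` changes
the lengths of `r` and of `rt` in the same direction, unless `sr = rt`. For `f ∈ Λ` it changes the
lengths of `r` and of `rf` in the same direction, unless `s` fixes `rf`.
-/

namespace RennerCoxeter

section Coxeter

open CoxeterSystem

variable {B W : Type*} [Group W] {M : CoxeterMatrix B} (cs : CoxeterSystem M W)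

/-! ### The exchange property -/

theorem alternatingWord_two_mul_succ (i j : B) (m : ℕ) :
    alternatingWord i j (2 * (m + 1)) = i :: j :: alternatingWord i j (2 * m) := by
  rw [Nat.mul_succ, alternatingWord_succ', alternatingWord_succ']
  simp

theorem reverse_alternatingWord_two_mul (i j : B) (m : ℕ) :
    (alternatingWord i j (2 * m)).reverse = alternatingWord j i (2 * m) := by
  induction m with
  | zero => simp [alternatingWord]
  | succ m ih =>
    rw [alternatingWord_two_mul_succ j i, ← ih, Nat.mul_succ, alternatingWord_succ,
      alternatingWord_succ]
    simp

theorem prod_map_alternatingWord {G : Type*} [Monoid G] (f : B → G) (i j : B) (m : ℕ) :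
    ((alternatingWord i j (2 * m)).map f).prod = (f i * f j) ^ m := by
  induction m with
  | zero => simp [alternatingWord]
  | succ m ih => rw [alternatingWord_two_mul_succ]; simp [ih, pow_succ', mul_assoc]

theorem exists_leftInvSeq_alternatingWord_eq_append (i j : B) :
    ∃ l : List W, cs.leftInvSeq (alternatingWord j i (2 * M i j)) = l ++ l := by
  set L := cs.leftInvSeq (alternatingWord j i (2 * M i j)) with hL
  have hlen : L.length = 2 * M i j := by simp [hL]
  have hdrop : L.drop (M i j) = L.take (M i j) := by
    apply List.ext_getElem
    · simp [hlen]; omega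
    · intro k h1 h2
      simp only [List.length_drop, hlen, List.length_take] at h1 h2
      simp only [List.getElem_drop, List.getElem_take, hL]
      rw [getElem_leftInvSeq_alternatingWord _ _ _ _ _ (by omega),
        getElem_leftInvSeq_alternatingWord _ _ _ _ _ (by omega),
        prod_alternatingWord_eq_mul_pow, prod_alternatingWord_eq_mul_pow,
        show (2 * (M i j + k) + 1) / 2 = M i j + k by omega,
        show (2 * k + 1) / 2 = k by omega, pow_add, simple_mul_simple_pow]
      simp
  exact ⟨L.take (M i j), by conv_lhs => rw [← List.take_append_drop (M i j) L, hdrop]⟩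

theorem exists_rightInvSeq_alternatingWord_eq_append (i j : B) :
    ∃ l : List W, cs.rightInvSeq (alternatingWord i j (2 * M i j)) = l ++ l := by
  obtain ⟨l, hl⟩ := exists_leftInvSeq_alternatingWord_eq_append cs i j
  refine ⟨l.reverse, ?_⟩
  rw [← reverse_alternatingWord_two_mul, rightInvSeq_reverse, hl, List.reverse_append]

open Classical in
/-- The action of a simple reflection on `W × ℤ/2` by which the parity of the number of
occurrences of an element in an inversion sequence is recorded. -/
noncomputable def inversionAct (i : B) : Function.End (W × ZMod 2) :=
  fun p => (cs.simple i * p.1 * cs.simple i, p.2 + if p.1 = cs.simple i then 1 else 0)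

open Classical in
theorem prod_map_inversionAct (ω : List B) (p : W × ZMod 2) :
    (ω.map (inversionAct cs)).prod p =
      (cs.wordProd ω * p.1 * (cs.wordProd ω)⁻¹, p.2 + ((cs.rightInvSeq ω).count p.1 : ℕ)) := by
  induction ω with
  | nil => simp; rfl
  | cons i ω ih =>
    rw [List.map_cons, List.prod_cons]
    change inversionAct cs i ((ω.map (inversionAct cs)).prod p) = _
    have hiff : cs.wordProd ω * (p.1 * (cs.wordProd ω)⁻¹) = cs.simple i ↔
        (cs.wordProd ω)⁻¹ * (cs.simple i * cs.wordProd ω) = p.1 := by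
      rw [← mul_assoc, mul_inv_eq_iff_eq_mul, inv_mul_eq_iff_eq_mul, eq_comm]
    rw [ih, inversionAct, rightInvSeq, List.count_cons, wordProd_cons]
    simp only [hiff, beq_iff_eq, mul_inv_rev, inv_simple, mul_assoc, Nat.cast_add, add_assoc,
      Nat.cast_ite, Nat.cast_one, Nat.cast_zero]

theorem isLiftable_inversionAct : M.IsLiftable (inversionAct cs) := by
  classical
  intro i j
  funext p
  obtain ⟨l, hl⟩ := exists_rightInvSeq_alternatingWord_eq_append cs i j
  rw [← prod_map_alternatingWord, prod_map_inversionAct, hl, wordProd, prod_map_alternatingWord,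
    simple_mul_simple_pow, List.count_append, Nat.cast_add, CharTwo.add_self_eq_zero]
  simp; rfl

theorem lift_inversionAct_wordProd (ω : List B) :
    cs.lift ⟨_, isLiftable_inversionAct cs⟩ (cs.wordProd ω) =
      (ω.map (inversionAct cs)).prod := by
  rw [wordProd, map_list_prod, List.map_map]
  congr 1
  exact List.map_congr_left fun i _ => cs.lift_apply_simple (isLiftable_inversionAct cs) i

open Classical in
theorem count_rightInvSeq_congr {ω ω' : List B} (h : cs.wordProd ω = cs.wordProd ω') (t : W) :
    (((cs.rightInvSeq ω).count t : ℕ) : ZMod 2) = ((cs.rightInvSeq ω').count t : ℕ) := by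
  have hprod : (ω.map (inversionAct cs)).prod (t, 0) = (ω'.map (inversionAct cs)).prod (t, 0) := by
    rw [← lift_inversionAct_wordProd, h, lift_inversionAct_wordProd]
  rw [prod_map_inversionAct, prod_map_inversionAct] at hprod
  simpa using congrArg Prod.snd hprod

theorem simple_mem_rightInvSeq_of_isRightDescent {ω : List B} {i : B}
    (h : cs.IsRightDescent (cs.wordProd ω) i) : cs.simple i ∈ cs.rightInvSeq ω := by
  classical
  obtain ⟨μ, hμ, hprod⟩ := cs.exists_isReduced (cs.wordProd ω * cs.simple i)
  have hnotMem : cs.simple i ∉ cs.rightInvSeq μ := by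
    intro hmem
    have hlt := (cs.isRightInversion_of_mem_rightInvSeq hμ hmem).2
    rw [← hprod, simple_mul_simple_cancel_right] at hlt
    exact lt_asymm h hlt
  have hcount : (cs.rightInvSeq (μ.concat i)).count (cs.simple i) = 1 := by
    rw [rightInvSeq_concat, List.concat_eq_append, List.count_append,
      List.count_eq_zero_of_not_mem, List.count_singleton_self]
    rw [List.mem_map]
    rintro ⟨t, ht, hti⟩
    have ht' : t = cs.simple i := by
      rw [← MulEquiv.eq_symm_apply, MulAut.conj_symm_apply] at hti
      simpa using hti
    exact hnotMem (ht' ▸ ht)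
  have hcongr := count_rightInvSeq_congr cs (ω := ω) (ω' := μ.concat i)
    (by rw [wordProd_concat, ← hprod, simple_mul_simple_cancel_right]) (cs.simple i)
  by_contra hn
  rw [hcount, List.count_eq_zero_of_not_mem hn] at hcongr
  exact absurd hcongr (by decide)

theorem exists_mul_simple_eq_wordProd_eraseIdx {ω : List B} {i : B}
    (h : cs.IsRightDescent (cs.wordProd ω) i) :
    ∃ j < ω.length, cs.wordProd ω * cs.simple i = cs.wordProd (ω.eraseIdx j) := by
  obtain ⟨j, hj, hji⟩ := List.mem_iff_getElem.mp (simple_mem_rightInvSeq_of_isRightDescent cs h)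
  refine ⟨j, by simpa using hj, ?_⟩
  rw [← wordProd_mul_getD_rightInvSeq, List.getD_eq_getElem _ 1 hj, hji]

theorem exists_isReduced_sublist (ω : List B) :
    ∃ ω' : List B, ω'.Sublist ω ∧ cs.IsReduced ω' ∧ cs.wordProd ω' = cs.wordProd ω := by
  induction ω using List.reverseRecOn with
  | nil => exact ⟨[], List.Sublist.refl _, by simp [CoxeterSystem.IsReduced], rfl⟩
  | append_singleton ω i ih =>
    obtain ⟨μ, hsub, hred, hprod⟩ := ih
    rw [wordProd_append, wordProd_singleton, ← hprod]
    by_cases hd : cs.IsRightDescent (cs.wordProd μ) i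
    · obtain ⟨j, hj, he⟩ := exists_mul_simple_eq_wordProd_eraseIdx cs hd
      refine ⟨μ.eraseIdx j, ((List.eraseIdx_sublist _ _).trans hsub).trans
        (List.sublist_append_left _ _), ?_, he.symm⟩
      have hlen := cs.isRightDescent_iff.1 hd
      rw [he, hred.eq] at hlen
      rw [CoxeterSystem.IsReduced, List.length_eraseIdx_of_lt hj]
      omega
    · refine ⟨μ ++ [i], hsub.append (List.Sublist.refl _), ?_, ?_⟩
      · rw [CoxeterSystem.IsReduced, wordProd_append, wordProd_singleton,
          cs.not_isRightDescent_iff.1 hd, hred.eq, List.length_append, List.length_singleton]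
      · rw [wordProd_append, wordProd_singleton]

theorem isLeftDescent_of_isReduced_cons {ω : List B} {i : B} (h : cs.IsReduced (i :: ω)) :
    cs.IsLeftDescent (cs.wordProd (i :: ω)) i := by
  rw [IsLeftDescent, h.eq, wordProd_cons, simple_mul_simple_cancel_left, List.length_cons]
  exact Nat.lt_succ_of_le (cs.length_wordProd_le ω)

theorem isRightDescent_of_isReduced_concat {ω : List B} {i : B} (h : cs.IsReduced (ω ++ [i])) :
    cs.IsRightDescent (cs.wordProd (ω ++ [i])) i := by
  rw [← cs.isLeftDescent_inv_iff, ← wordProd_reverse]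
  have hrev := h.reverse
  rw [List.reverse_concat] at hrev ⊢
  exact isLeftDescent_of_isReduced_cons cs hrev

/-! ### Parabolic subgroups and reduced coset representatives -/

/-- The standard parabolic subgroup `W_I` generated by the simple reflections in `I`. -/
def parabolic (I : Set B) : Subgroup W := Subgroup.closure (cs.simple '' I)

/-- `x` is the shortest element of its left coset `x W_I`, encoded by the absence of right descents
in `I`. -/
def IsRightReduced (I : Set B) (x : W) : Prop := ∀ i ∈ I, ¬ cs.IsRightDescent x i

/-- `x` is the shortest element of its right coset `W_I x`, encoded by the absence of left descents
in `I`. -/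
def IsLeftReduced (I : Set B) (x : W) : Prop := ∀ i ∈ I, ¬ cs.IsLeftDescent x i

variable {cs} {I J K : Set B} {x y a b w : W} {i j : B}

theorem isRightReduced_inv_iff : IsRightReduced cs I x⁻¹ ↔ IsLeftReduced cs I x := by
  simp only [IsRightReduced, IsLeftReduced, cs.isRightDescent_inv_iff]

theorem isLeftReduced_inv_iff : IsLeftReduced cs I x⁻¹ ↔ IsRightReduced cs I x := by
  simp only [IsRightReduced, IsLeftReduced, cs.isLeftDescent_inv_iff]

theorem parabolic_mono (h : I ⊆ J) : parabolic cs I ≤ parabolic cs J :=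
  Subgroup.closure_mono (Set.image_mono h)

theorem simple_mem_parabolic (hi : i ∈ I) : cs.simple i ∈ parabolic cs I :=
  Subgroup.subset_closure ⟨i, hi, rfl⟩

theorem wordProd_mem_parabolic {ω : List B} (h : ∀ i ∈ ω, i ∈ I) :
    cs.wordProd ω ∈ parabolic cs I := by
  refine Subgroup.list_prod_mem _ fun x hx => ?_
  obtain ⟨i, hi, rfl⟩ := List.mem_map.1 hx
  exact simple_mem_parabolic (h i hi)

theorem exists_wordProd_eq_of_mem_parabolic (h : a ∈ parabolic cs I) :
    ∃ ω : List B, (∀ i ∈ ω, i ∈ I) ∧ cs.wordProd ω = a := by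
  induction h using Subgroup.closure_induction with
  | mem x hx =>
    obtain ⟨i, hi, rfl⟩ := hx
    exact ⟨[i], by simpa only [List.mem_singleton, forall_eq] using hi, cs.wordProd_singleton i⟩
  | one => exact ⟨[], by simp, cs.wordProd_nil⟩
  | mul x y _ _ hx hy =>
    obtain ⟨ω, hω, rfl⟩ := hx
    obtain ⟨μ, hμ, rfl⟩ := hy
    exact ⟨ω ++ μ, List.forall_mem_append.2 ⟨hω, hμ⟩, cs.wordProd_append _ _⟩
  | inv x _ hx =>
    obtain ⟨ω, hω, rfl⟩ := hx
    exact ⟨ω.reverse, fun i hi => hω i (List.mem_reverse.1 hi), cs.wordProd_reverse _⟩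

theorem exists_isReduced_of_mem_parabolic (h : a ∈ parabolic cs I) :
    ∃ ω : List B, (∀ i ∈ ω, i ∈ I) ∧ cs.IsReduced ω ∧ cs.wordProd ω = a := by
  obtain ⟨ω, hω, rfl⟩ := exists_wordProd_eq_of_mem_parabolic h
  obtain ⟨μ, hsub, hred, he⟩ := exists_isReduced_sublist cs ω
  exact ⟨μ, fun i hi => hω i (hsub.subset hi), hred, he⟩

theorem exists_isRightDescent_of_mem_parabolic (h : a ∈ parabolic cs I) (h1 : a ≠ 1) :
    ∃ i ∈ I, cs.IsRightDescent a i := by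
  obtain ⟨ω, hω, hred, rfl⟩ := exists_isReduced_of_mem_parabolic h
  rcases List.eq_nil_or_concat ω with rfl | ⟨μ, i, rfl⟩
  · exact absurd cs.wordProd_nil h1
  · rw [List.concat_eq_append] at *
    exact ⟨i, hω i (by simp), isRightDescent_of_isReduced_concat cs hred⟩

theorem exists_simple_eq_of_mem_parabolic (h : cs.simple i ∈ parabolic cs I) :
    ∃ j ∈ I, cs.simple i = cs.simple j := by
  obtain ⟨ω, hω, hred, he⟩ := exists_isReduced_of_mem_parabolic h
  have hlen := hred.eq
  rw [he, length_simple, eq_comm, List.length_eq_one_iff] at hlen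
  obtain ⟨j, rfl⟩ := hlen
  exact ⟨j, hω j (List.mem_singleton_self j), he.symm.trans (cs.wordProd_singleton j)⟩

theorem length_mul_of_minimal (hx : ∀ b ∈ parabolic cs I, cs.length x ≤ cs.length (x * b))
    (ha : a ∈ parabolic cs I) : cs.length (x * a) = cs.length x + cs.length a := by
  obtain ⟨ω, hω, hωred, rfl⟩ := exists_isReduced_of_mem_parabolic ha
  obtain ⟨ν, hν, rfl⟩ := cs.exists_isReduced x
  obtain ⟨μ, hsub, hred, he⟩ := exists_isReduced_sublist cs (ν ++ ω)
  obtain ⟨ν', ω', rfl, hν', hω'⟩ := List.sublist_append_iff.1 hsub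
  rw [wordProd_append, wordProd_append] at he
  -- Deleting letters of `ν` would produce an element of `x W_I` that is shorter than `x`.
  have hνν' : ν' = ν := by
    refine hν'.eq_of_length_le ?_
    have hmin := hx (cs.wordProd ω * (cs.wordProd ω')⁻¹) (mul_mem ha
      (inv_mem (wordProd_mem_parabolic fun i hi => hω i (hω'.subset hi))))
    rw [← mul_assoc, ← he, mul_inv_cancel_right, hν.eq] at hmin
    exact hmin.trans (cs.length_wordProd_le ν')
  subst hνν'
  have hlen := cs.length_wordProd_le ω'
  rw [mul_left_cancel he] at hlen
  rw [← he, ← wordProd_append, hred.eq, List.length_append, hν.eq]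
  rw [hωred.eq] at hlen ⊢
  exact congrArg _ (le_antisymm hω'.length_le hlen)

theorem exists_minimal_mul (cs : CoxeterSystem M W) (I : Set B) (w : W) :
    ∃ x, ∃ a ∈ parabolic cs I, w = x * a ∧
      ∀ b ∈ parabolic cs I, cs.length x ≤ cs.length (x * b) := by
  obtain ⟨b, hb, hmin⟩ := exists_minimalFor_of_wellFoundedLT (· ∈ parabolic cs I)
    (fun b => cs.length (w * b)) ⟨1, one_mem _⟩
  refine ⟨w * b, b⁻¹, inv_mem hb, (mul_inv_cancel_right w b).symm, fun c hc => ?_⟩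
  rw [mul_assoc]
  exact not_lt.1 fun hlt => (hmin (mul_mem hb hc) hlt.le).not_gt hlt

theorem IsRightReduced.length_mul (hx : IsRightReduced cs I x) (ha : a ∈ parabolic cs I) :
    cs.length (x * a) = cs.length x + cs.length a := by
  obtain ⟨y, b, hb, rfl, hmin⟩ := exists_minimal_mul cs I x
  have hb1 : b = 1 := by
    by_contra h1
    obtain ⟨i, hi, hd⟩ := exists_isRightDescent_of_mem_parabolic hb h1
    refine hx i hi ?_
    rw [IsRightDescent, mul_assoc, length_mul_of_minimal hmin hb,
      length_mul_of_minimal hmin (mul_mem hb (simple_mem_parabolic hi))]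
    exact Nat.add_lt_add_left hd _
  rw [hb1, mul_one]
  exact length_mul_of_minimal hmin ha

theorem IsLeftReduced.length_mul (hx : IsLeftReduced cs I x) (ha : a ∈ parabolic cs I) :
    cs.length (a * x) = cs.length a + cs.length x := by
  rw [← cs.length_inv, mul_inv_rev, (isRightReduced_inv_iff.2 hx).length_mul (inv_mem ha),
    cs.length_inv, cs.length_inv, add_comm]

theorem IsRightReduced.eq_one_of_mul (hx : IsRightReduced cs I x) (ha : a ∈ parabolic cs I)
    (hxa : IsRightReduced cs I (x * a)) : a = 1 := by
  have h1 := hx.length_mul ha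
  have h2 := hxa.length_mul (inv_mem ha)
  rw [mul_inv_cancel_right, cs.length_inv] at h2
  rw [← cs.length_eq_zero_iff]
  omega

theorem IsLeftReduced.eq_one_of_mul (hx : IsLeftReduced cs I x) (ha : a ∈ parabolic cs I)
    (hax : IsLeftReduced cs I (a * x)) : a = 1 := by
  rw [← isRightReduced_inv_iff] at hx hax
  rw [mul_inv_rev] at hax
  exact inv_eq_one.1 (hx.eq_one_of_mul (inv_mem ha) hax)

theorem IsLeftReduced.of_mul (h : IsLeftReduced cs I (x * b))
    (hlen : cs.length (x * b) = cs.length x + cs.length b) : IsLeftReduced cs I x := by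
  intro i hi hd
  refine h i hi ?_
  have hle := cs.length_mul_le (cs.simple i * x) b
  rw [IsLeftDescent] at *
  rw [mul_assoc] at hle
  omega

theorem exists_isRightReduced_mul (cs : CoxeterSystem M W) (I : Set B) (w : W) :
    ∃ x, ∃ a ∈ parabolic cs I, w = x * a ∧ IsRightReduced cs I x := by
  obtain ⟨x, a, ha, hw, hmin⟩ := exists_minimal_mul cs I w
  exact ⟨x, a, ha, hw, fun i hi => not_lt.2 (hmin _ (simple_mem_parabolic hi))⟩

theorem exists_mul_isLeftReduced (cs : CoxeterSystem M W) (I : Set B) (w : W) :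
    ∃ a ∈ parabolic cs I, ∃ x, w = a * x ∧ IsLeftReduced cs I x := by
  obtain ⟨x, a, ha, hw, hx⟩ := exists_isRightReduced_mul cs I w⁻¹
  refine ⟨a⁻¹, inv_mem ha, x⁻¹, ?_, isLeftReduced_inv_iff.2 hx⟩
  rw [← mul_inv_rev, ← hw, inv_inv]

theorem mem_parabolic_of_double_reduced (hl : IsLeftReduced cs I x) (hr : IsRightReduced cs J x)
    (ha : a ∈ parabolic cs I) (hy : y ∈ parabolic cs K) (hb : b ∈ parabolic cs J)
    (h : x = a * y * b) : x ∈ parabolic cs K := by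
  obtain ⟨α, hα, -, rfl⟩ := exists_isReduced_of_mem_parabolic ha
  obtain ⟨β, hβ, -, rfl⟩ := exists_isReduced_of_mem_parabolic hb
  obtain ⟨υ, hυ, -, rfl⟩ := exists_isReduced_of_mem_parabolic hy
  rw [← wordProd_append, ← wordProd_append] at h
  obtain ⟨μ, hsub, hred, he⟩ := exists_isReduced_sublist cs (α ++ υ ++ β)
  obtain ⟨μ', β', rfl, hsub', hβ'⟩ := List.sublist_append_iff.1 hsub
  obtain ⟨α', υ', rfl, hα', hυ'⟩ := List.sublist_append_iff.1 hsub'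
  rw [← he] at h
  have hα'nil : α' = [] := by
    rcases α' with _ | ⟨i, α'⟩
    · rfl
    · exact absurd (h ▸ isLeftDescent_of_isReduced_cons cs hred)
        (hl i (hα i (hα'.subset List.mem_cons_self)))
  have hβ'nil : β' = [] := by
    rcases List.eq_nil_or_concat β' with rfl | ⟨β', i, rfl⟩
    · rfl
    · rw [List.concat_eq_append, ← List.append_assoc] at *
      exact absurd (h ▸ isRightDescent_of_isReduced_concat cs hred)
        (hr i (hβ i (hβ'.subset (by simp))))
  rw [h, hα'nil, hβ'nil, List.nil_append, List.append_nil]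
  exact wordProd_mem_parabolic fun i hi => hυ i (hυ'.subset hi)

theorem simple_mul_eq_mul_simple (hl : ¬ cs.IsLeftDescent w i) (hr : ¬ cs.IsRightDescent w j)
    (h : cs.length (cs.simple i * w * cs.simple j) < cs.length (w * cs.simple j)) :
    cs.simple i * w = w * cs.simple j := by
  obtain ⟨ω, hω, rfl⟩ := cs.exists_isReduced w
  rw [not_isLeftDescent_iff] at hl
  rw [not_isRightDescent_iff] at hr
  have hcons : cs.wordProd (i :: ω) = cs.simple i * cs.wordProd ω := cs.wordProd_cons _ _
  have hd : cs.IsRightDescent (cs.wordProd (i :: ω)) j := by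
    rw [hcons, IsRightDescent]; omega
  obtain ⟨k, hk, he⟩ := exists_mul_simple_eq_wordProd_eraseIdx cs hd
  rcases k with _ | k
  · rw [hcons, List.eraseIdx_zero, List.tail_cons] at he
    simpa only [simple_mul_simple_cancel_right] using congrArg (· * cs.simple j) he
  · rw [hcons, List.eraseIdx_cons_succ, wordProd_cons, mul_assoc, mul_left_cancel_iff] at he
    have hle := cs.length_wordProd_le (ω.eraseIdx k)
    rw [List.length_eraseIdx_of_lt (by simpa using hk), ← he] at hle
    rw [hω.eq] at hr
    omega

/-- Deodhar's lemma. -/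
theorem IsRightReduced.simple_mul (hx : IsRightReduced cs I x) (i : B) :
    IsRightReduced cs I (cs.simple i * x) ∨ ∃ j ∈ I, cs.simple i * x = x * cs.simple j := by
  by_contra! hcon
  obtain ⟨hnot, hne⟩ := hcon
  simp only [IsRightReduced, not_forall, not_not] at hnot
  obtain ⟨j, hj, hd⟩ := hnot
  have h1 := cs.not_isRightDescent_iff.1 (hx j hj)
  have h2 := cs.isRightDescent_iff.1 hd
  have h3 := cs.length_simple_mul (x * cs.simple j) i
  have h4 := cs.length_simple_mul x i
  rw [← mul_assoc] at h3
  refine hne j hj (simple_mul_eq_mul_simple (fun h => ?_) (hx j hj) (by omega))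
  rw [isLeftDescent_iff] at h
  omega

theorem IsLeftReduced.mul_simple (hx : IsLeftReduced cs I x) (i : B) :
    IsLeftReduced cs I (x * cs.simple i) ∨ ∃ j ∈ I, x * cs.simple i = cs.simple j * x := by
  refine ((isRightReduced_inv_iff.2 hx).simple_mul i).imp (fun h => ?_) ?_
  · rwa [← isRightReduced_inv_iff, mul_inv_rev, inv_simple]
  · rintro ⟨j, hj, h⟩
    exact ⟨j, hj, by simpa using congrArg (·⁻¹) h⟩

theorem commute_of_mem_parabolic
    (hc : ∀ i ∈ I, ∀ j ∈ J, cs.simple i * cs.simple j = cs.simple j * cs.simple i)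
    (ha : a ∈ parabolic cs I) (hb : b ∈ parabolic cs J) : a * b = b * a := by
  have hle : parabolic cs I ≤ Subgroup.centralizer (parabolic cs J) := by
    rw [parabolic, Subgroup.closure_le, parabolic, Subgroup.centralizer_closure]
    rintro _ ⟨i, hi, rfl⟩
    rw [SetLike.mem_coe, Subgroup.mem_centralizer_iff]
    rintro _ ⟨j, hj, rfl⟩
    exact (hc i hi j hj).symm
  exact (Subgroup.mem_centralizer_iff.1 (hle ha) b hb).symm

theorem IsRightReduced.mul_simple_of_commute (hx : IsRightReduced cs I x)
    (hc : ∀ i ∈ I, cs.simple i * cs.simple j = cs.simple j * cs.simple i)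
    (hne : ∀ i ∈ I, cs.simple i ≠ cs.simple j) : IsRightReduced cs I (x * cs.simple j) := by
  intro i hi hd
  have hup := cs.not_isRightDescent_iff.1 (hx i hi)
  have hdown := cs.isRightDescent_iff.1 hd
  have hswap : x * cs.simple j * cs.simple i = x * cs.simple i * cs.simple j := by
    rw [mul_assoc, mul_assoc, hc i hi]
  have hj := cs.length_mul_simple (x * cs.simple i) j
  rw [← hswap] at hj
  rcases cs.length_mul_simple x j with hxj | hxj
  · have hxij : IsRightReduced cs {i, j} x := by
      rintro l (rfl | rfl)
      exacts [hx _ hi, cs.not_isRightDescent_iff.2 hxj]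
    have hlen := hxij.length_mul (a := cs.simple j * cs.simple i)
      (mul_mem (simple_mem_parabolic (by simp)) (simple_mem_parabolic (by simp)))
    rw [← mul_assoc] at hlen
    have h1 : cs.simple j * cs.simple i = 1 := by rw [← cs.length_eq_zero_iff]; omega
    exact hne i hi (by rw [← cs.inv_simple j, inv_eq_of_mul_eq_one_right h1])
  · omega

theorem IsRightReduced.mul_of_commute (hx : IsRightReduced cs I x)
    (hc : ∀ i ∈ I, ∀ j ∈ J, cs.simple i * cs.simple j = cs.simple j * cs.simple i)
    (hne : ∀ i ∈ I, ∀ j ∈ J, cs.simple i ≠ cs.simple j) (ha : a ∈ parabolic cs J) :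
    IsRightReduced cs I (x * a) := by
  obtain ⟨ω, hω, rfl⟩ := exists_wordProd_eq_of_mem_parabolic ha
  clear ha
  induction ω using List.reverseRecOn with
  | nil => rwa [wordProd_nil, mul_one]
  | append_singleton ω k ih =>
    have hk : k ∈ J := hω k (by simp)
    rw [wordProd_append, wordProd_singleton, ← mul_assoc]
    exact (ih fun j hj => hω j (by simp [hj])).mul_simple_of_commute
      (fun i hi => hc i hi k hk) (fun i hi => hne i hi k hk)

theorem isRightReduced_simple (hne : ∀ i ∈ I, cs.simple i ≠ cs.simple j) :
    IsRightReduced cs I (cs.simple j) := by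
  intro i hi hd
  rw [IsRightDescent, cs.length_simple, Nat.lt_one_iff, cs.length_eq_zero_iff] at hd
  exact hne i hi (by rw [← cs.inv_simple j, inv_eq_of_mul_eq_one_right hd])

theorem isLeftReduced_simple (hne : ∀ i ∈ I, cs.simple i ≠ cs.simple j) :
    IsLeftReduced cs I (cs.simple j) := by
  rw [← isRightReduced_inv_iff, inv_simple]
  exact isRightReduced_simple hne

theorem simple_mul_simple_comm_of_conj_mem_parabolic (hi : i ∈ I)
    (hj : cs.simple j ∉ parabolic cs I)
    (hconj : cs.simple j * cs.simple i * cs.simple j ∈ parabolic cs I) :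
    cs.simple i * cs.simple j = cs.simple j * cs.simple i := by
  have hne : ∀ k ∈ I, cs.simple k ≠ cs.simple j := fun k hk hkj =>
    hj (hkj ▸ simple_mem_parabolic hk)
  have hlen : cs.length (cs.simple j * cs.simple i * cs.simple j) = 1 := by
    have h := (isLeftReduced_simple hne).length_mul hconj
    rw [simple_mul_simple_cancel_right,
      (isRightReduced_simple hne).length_mul (simple_mem_parabolic hi), length_simple,
      length_simple] at h
    omega
  obtain ⟨k, hk⟩ := cs.length_eq_one_iff.1 hlen
  have hpair : cs.simple k ∈ parabolic cs {i, j} := by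
    rw [← hk]
    refine mul_mem (mul_mem ?_ ?_) ?_ <;> exact simple_mem_parabolic (by simp)
  obtain ⟨l, rfl | rfl, hl⟩ := exists_simple_eq_of_mem_parabolic hpair
  · rw [← simple_mul_simple_cancel_left cs j (w := cs.simple l * cs.simple j), ← mul_assoc _ _
      (cs.simple j), hk, hl]
  · exact absurd (hl ▸ hk ▸ hconj) hj

end Coxeter

/-! ### The idempotents of a generalised Renner–Coxeter system -/

section Types

variable {R : Type*} [Monoid R] {B : Type*} {M : CoxeterMatrix B} (cs : CoxeterSystem M Rˣ)

/-- The type of `W(e)`: the indices of the simple reflections that commute with `e`. -/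
def commType (e : R) : Set B := {i | cs.simple i ∈ centralizer e}

/-- The type of `W_⋆(e)`: the indices of the simple reflections that fix `e`. -/
def fixType (e : R) : Set B := {i | cs.simple i ∈ fixer e}

/-- The set `λ^⋆(e)` in terms of indices: the simple reflections that commute with `e` and do not
fix it. -/
def moveType (e : R) : Set B := commType cs e \ fixType cs e

theorem fixer_le_centralizer (e : R) : fixer e ≤ centralizer e :=
  fun _ hw => hw.1.trans hw.2.symm

theorem conj_mem_fixer {e : R} {a b : Rˣ} (ha : a ∈ centralizer e) (hb : b ∈ fixer e) :
    a * b * a⁻¹ ∈ fixer e := by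
  have ha' : ((a⁻¹ : Rˣ) : R) * e = e * ((a⁻¹ : Rˣ) : R) := inv_mem ha
  have ha : (a : R) * e = e * a := ha
  constructor
  · rw [Units.val_mul, Units.val_mul, mul_assoc, ha', ← mul_assoc, mul_assoc (a : R), hb.1, ha,
      mul_assoc, Units.mul_inv, mul_one]
  · rw [Units.val_mul, Units.val_mul, ← mul_assoc, ← mul_assoc, ← ha, mul_assoc (a : R), hb.2, ha,
      mul_assoc, Units.mul_inv, mul_one]

theorem IsStandardParabolic.eq_parabolic {W : Type*} [Group W] {S : Set W} {M : CoxeterMatrix S}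
    {cs : CoxeterSystem M W} (hcs : ∀ s : S, cs.simple s = s) {H : Subgroup W}
    (hH : IsStandardParabolic S H) : H = parabolic cs {i | cs.simple i ∈ H} := by
  obtain ⟨I, hI, rfl⟩ := hH
  refine le_antisymm ((Subgroup.closure_le _).2 fun s hs => ?_) ((Subgroup.closure_le _).2 ?_)
  · have hmem : cs.simple ⟨s, hI hs⟩ ∈ Subgroup.closure I := by
      rw [hcs]
      exact Subgroup.subset_closure hs
    simpa only [hcs, SetLike.mem_coe] using
      simple_mem_parabolic (cs := cs) (I := {i | cs.simple i ∈ Subgroup.closure I}) hmem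
  · rintro _ ⟨i, hi, rfl⟩
    exact hi

end Types

section System

variable {R : Type*} [Monoid R] {Λ : Set R} {S : Set Rˣ} {M : CoxeterMatrix S}
  {cs : CoxeterSystem M Rˣ}

theorem conj_one (e : R) : conj 1 e = e := by simp [conj]

theorem conj_mul (v w : Rˣ) (e : R) : conj (v * w) e = conj v (conj w e) := by
  simp [conj, mul_assoc]

theorem conj_mul_distrib (w : Rˣ) (e f : R) : conj w (e * f) = conj w e * conj w f := by
  simp [conj, mul_assoc]

theorem conj_eq_iff_eq_conj_inv {w : Rˣ} {e f : R} : conj w e = f ↔ e = conj w⁻¹ f := by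
  constructor <;> rintro rfl <;> rw [← conj_mul] <;> simp [conj_one]

theorem isIdempotentElem_conj {e : R} (he : IsIdempotentElem e) (w : Rˣ) :
    IsIdempotentElem (conj w e) := by
  rw [IsIdempotentElem, ← conj_mul_distrib, he.eq]

theorem IdemLE.conj {e f : R} (hef : IdemLE e f) (w : Rˣ) : IdemLE (conj w e) (conj w f) := by
  constructor
  · rw [← conj_mul_distrib, hef.1]
  · rw [← conj_mul_distrib, hef.2]

theorem mem_centralizer_iff_conj_eq {w : Rˣ} {e : R} : w ∈ centralizer e ↔ conj w e = e := by
  rw [conj, Units.mul_inv_eq_iff_eq_mul]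
  rfl

theorem mul_mul_unit_of_mem_fixer {e : R} {a : Rˣ} (ha : a ∈ fixer e) (w v : Rˣ) :
    ((w * a : Rˣ) : R) * e * v = w * e * v := by
  rw [Units.val_mul, mul_assoc (w : R), ha.1]

theorem mul_mul_unit_comm {e : R} {a : Rˣ} (ha : a ∈ centralizer e) (w v : Rˣ) :
    ((w * a : Rˣ) : R) * e * v = w * e * ((a * v : Rˣ) : R) := by
  have ha : (a : R) * e = e * a := ha
  rw [Units.val_mul, mul_assoc (w : R), ha, Units.val_mul]
  simp only [mul_assoc]

namespace IsFactorisable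

variable (hR : IsFactorisable R) {e f : R}

include hR

theorem isIdempotentElem_mul (he : IsIdempotentElem e) (hf : IsIdempotentElem f) :
    IsIdempotentElem (e * f) :=
  he.mul_of_commute (hR.idem_comm e f he hf) hf

theorem idemLE_of_mul_eq (he : IsIdempotentElem e) (hf : IsIdempotentElem f) (hef : e * f = e) :
    IdemLE e f :=
  ⟨hef, by rw [hR.idem_comm f e hf he, hef]⟩

theorem mul_idemLE_right (he : IsIdempotentElem e) (hf : IsIdempotentElem f) :
    IdemLE (e * f) f :=
  hR.idemLE_of_mul_eq (hR.isIdempotentElem_mul he hf) hf (by rw [mul_assoc, hf.eq])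

theorem mul_idemLE_left (he : IsIdempotentElem e) (hf : IsIdempotentElem f) :
    IdemLE (e * f) e :=
  hR.idem_comm e f he hf ▸ hR.mul_idemLE_right hf he

theorem mem_fixer_of_mul_eq (he : IsIdempotentElem e) {u : Rˣ} (hu : e * u = e) :
    u ∈ fixer e := by
  have hconj : conj u⁻¹ e = ((u⁻¹ : Rˣ) : R) * e := by rw [conj, inv_inv, mul_assoc, hu]
  have hcomm := hR.idem_comm _ _ he (isIdempotentElem_conj he u⁻¹)
  have hu' : e * ((u⁻¹ : Rˣ) : R) = e := by rw [Units.mul_inv_eq_iff_eq_mul, hu]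
  rw [hconj, ← mul_assoc, hu', he.eq, mul_assoc, he.eq] at hcomm
  exact ⟨by rw [← Units.eq_inv_mul_iff_mul_eq]; exact hcomm, hu⟩

theorem eq_of_eq_mul_unit (he : IsIdempotentElem e) (hf : IsIdempotentElem f) {u : Rˣ}
    (hu : e = f * u) : e = f := by
  have hfe : f * e = e := by rw [hu, ← mul_assoc, hf.eq]
  have hef : e * f = f := by
    have hu' : f = e * ((u⁻¹ : Rˣ) : R) := by rw [Units.eq_mul_inv_iff_mul_eq, hu]
    rw [hu', ← mul_assoc, he.eq]
  rw [← hfe, hR.idem_comm f e hf he, hef]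

end IsFactorisable

namespace IsSystem

variable (h : IsSystem Λ S) (hcs : ∀ s : S, cs.simple s = s)

include h

theorem eq_of_conj_eq {e f : R} (he : e ∈ Λ) (hf : f ∈ Λ) {w : Rˣ} (hw : conj w e = f) :
    e = f := by
  obtain ⟨g, -, hg⟩ := h.transversal e (h.idem_of_mem e he)
  rw [hg e ⟨he, 1, conj_one e⟩, hg f ⟨hf, w, hw⟩]

theorem one_mem : (1 : R) ∈ Λ := by
  obtain ⟨g, ⟨hg, w, hw⟩, -⟩ := h.transversal 1 (IsIdempotentElem.one)
  rw [conj, mul_one, Units.mul_inv] at hw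
  rwa [hw]

theorem exists_conj_eq_of_idemLE {f p : R} (hf : f ∈ Λ) (hp : IsIdempotentElem p)
    (hpf : IdemLE p f) : ∃ g ∈ Λ, IdemLE g f ∧ ∃ v ∈ centralizer f, conj v g = p := by
  obtain ⟨v, g, f', hg, hf', hgf, hvg, hvf⟩ := h.conj_pair p f hp (h.idem_of_mem f hf) hpf
  obtain rfl := h.eq_of_conj_eq hf' hf hvf
  exact ⟨g, hg, hgf, v, mem_centralizer_iff_conj_eq.2 hvf, hvg⟩

theorem eq_of_idemLE_of_conj_eq {g p : R} (hg : g ∈ Λ) (hp : IsIdempotentElem p)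
    (hgp : IdemLE g p) {u : Rˣ} (hu : conj u g = p) : g = p := by
  obtain ⟨w, g₁, g₂, hg₁, hg₂, -, hw₁, hw₂⟩ := h.conj_pair g p (h.idem_of_mem g hg) hp hgp
  obtain rfl := h.eq_of_conj_eq hg₁ hg hw₁
  obtain rfl := h.eq_of_conj_eq (w := u⁻¹ * w) hg₂ hg
    (by rw [conj_mul, hw₂, ← conj_eq_iff_eq_conj_inv.1 hu])
  rw [← hw₁, hw₂]

theorem eq_of_mul_mul_eq {e f : R} (he : e ∈ Λ) (hf : f ∈ Λ) {w₁ w₂ v₁ v₂ : Rˣ}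
    (heq : (w₁ : R) * e * w₂ = v₁ * f * v₂) :
    e = f ∧ w₁⁻¹ * v₁ ∈ centralizer e ∧ w₁⁻¹ * v₁ * (v₂ * w₂⁻¹) ∈ fixer e := by
  have hei := h.idem_of_mem e he
  have hconj : e = conj (w₁⁻¹ * v₁) f * ((w₁⁻¹ * v₁ * (v₂ * w₂⁻¹) : Rˣ) : R) := by
    have he' : e = ((w₁⁻¹ : Rˣ) : R) * (w₁ * e * w₂) * ((w₂⁻¹ : Rˣ) : R) := by simp [mul_assoc]
    rw [he', heq]
    simp [conj, mul_assoc]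
  have hfe : e = conj (w₁⁻¹ * v₁) f :=
    h.factorisable.eq_of_eq_mul_unit hei (isIdempotentElem_conj (h.idem_of_mem f hf) _) hconj
  obtain rfl := h.eq_of_conj_eq hf he hfe.symm
  rw [← hfe] at hconj
  exact ⟨rfl, mem_centralizer_iff_conj_eq.2 hfe.symm,
    h.factorisable.mem_fixer_of_mul_eq hei hconj.symm⟩

include hcs

theorem centralizer_eq {e : R} (he : e ∈ Λ) : centralizer e = parabolic cs (commType cs e) :=
  (h.parabolic_centralizer e he).eq_parabolic hcs

theorem fixer_eq {e : R} (he : e ∈ Λ) : fixer e = parabolic cs (fixType cs e) :=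
  (h.parabolic_fixer e he).eq_parabolic hcs

omit h in
theorem mem_moveType_iff {e : R} {i : S} : i ∈ moveType cs e ↔ (i : Rˣ) ∈ upperType S e := by
  simp only [moveType, commType, fixType, Set.mem_sdiff, Set.mem_ofPred_eq, hcs]
  constructor
  · rintro ⟨hcomm, hnot⟩
    exact ⟨i.2, hcomm, fun hfix => hnot ⟨Eq.trans hcomm hfix, hfix⟩⟩
  · rintro ⟨-, hcomm, hnot⟩
    exact ⟨hcomm, fun hfix => hnot hfix.2⟩

theorem moveType_mono {e f : R} (he : e ∈ Λ) (hf : f ∈ Λ) (hle : IdemLE e f) :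
    moveType cs e ⊆ moveType cs f := fun i hi => by
  rw [mem_moveType_iff hcs] at *
  exact h.upperType_mono e he f hf hle hi

omit h hcs in
theorem simple_ne_simple {e : R} {i j : S} (hi : i ∈ fixType cs e) (hj : j ∈ moveType cs e) :
    cs.simple i ≠ cs.simple j :=
  fun hij => hj.2 (show cs.simple j ∈ fixer e from hij ▸ hi)

theorem simple_mul_simple_comm {e : R} (he : e ∈ Λ) {i j : S} (hi : i ∈ fixType cs e)
    (hj : j ∈ moveType cs e) : cs.simple i * cs.simple j = cs.simple j * cs.simple i := by
  have hfix := h.fixer_eq hcs he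
  refine simple_mul_simple_comm_of_conj_mem_parabolic hi (hfix ▸ hj.2) ?_
  have hconj := conj_mem_fixer hj.1 hi
  rwa [cs.inv_simple, hfix] at hconj

theorem mul_comm_of_mem {e : R} (he : e ∈ Λ) {a b : Rˣ} (ha : a ∈ fixer e)
    (hb : b ∈ parabolic cs (moveType cs e)) : a * b = b * a :=
  commute_of_mem_parabolic (fun _ hi _ hj => h.simple_mul_simple_comm hcs he hi hj)
    (h.fixer_eq hcs he ▸ ha) hb

theorem isRightReduced_mul {e : R} (he : e ∈ Λ) {x b : Rˣ}
    (hx : IsRightReduced cs (fixType cs e) x) (hb : b ∈ parabolic cs (moveType cs e)) :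
    IsRightReduced cs (fixType cs e) (x * b) :=
  hx.mul_of_commute (fun _ hi _ hj => h.simple_mul_simple_comm hcs he hi hj)
    (fun _ hi _ hj => simple_ne_simple hi hj) hb

theorem parabolic_moveType_le {e : R} (he : e ∈ Λ) :
    parabolic cs (moveType cs e) ≤ centralizer e :=
  h.centralizer_eq hcs he ▸ parabolic_mono Set.sdiff_subset

theorem exists_eq_mul_of_mem_centralizer {e : R} (he : e ∈ Λ) {a : Rˣ} (ha : a ∈ centralizer e) :
    ∃ c ∈ parabolic cs (moveType cs e), ∃ b ∈ fixer e, a = c * b := by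
  rw [h.centralizer_eq hcs he] at ha
  obtain ⟨ω, hω, rfl⟩ := exists_wordProd_eq_of_mem_parabolic ha
  clear ha
  induction ω with
  | nil => exact ⟨1, Subgroup.one_mem _, 1, Subgroup.one_mem _, by simp⟩
  | cons i ω ih =>
    obtain ⟨c, hc, b, hb, hcb⟩ := ih fun j hj => hω j (List.mem_cons_of_mem i hj)
    rw [cs.wordProd_cons, hcb]
    by_cases hi : i ∈ fixType cs e
    · refine ⟨c, hc, cs.simple i * b, Subgroup.mul_mem _ hi hb, ?_⟩
      rw [← mul_assoc, h.mul_comm_of_mem hcs he hi hc, mul_assoc]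
    · have hmove : i ∈ moveType cs e := ⟨hω i List.mem_cons_self, hi⟩
      exact ⟨cs.simple i * c, Subgroup.mul_mem _ (simple_mem_parabolic hmove) hc, b, hb,
        (mul_assoc _ _ _).symm⟩

theorem length_mul_of_mem {e : R} (he : e ∈ Λ) {c b : Rˣ}
    (hc : c ∈ parabolic cs (moveType cs e)) (hb : b ∈ fixer e) :
    cs.length (c * b) = cs.length c + cs.length b := by
  have hred := h.isRightReduced_mul hcs he (x := 1) (fun i _ => cs.not_isRightDescent_one i) hc
  rw [one_mul] at hred
  exact hred.length_mul (h.fixer_eq hcs he ▸ hb)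

/-- As `f · x e x⁻¹` is below `f` and below `x e x⁻¹`, it is conjugate to some `g ∈ Λ` by an element
of `W(f)` and by an element of `x W(e)`. Hence `x ∈ W(f) W_⋆(g) W(e)`, as `λ^⋆(g) ⊆ λ^⋆(f)`, and
then `x ∈ W_⋆(g)`, as `x` is shortest in its double coset. -/
theorem exists_mem_fixer_conj_eq {e f : R} (he : e ∈ Λ) (hf : f ∈ Λ) {x : Rˣ}
    (hl : IsLeftReduced cs (commType cs f) x) (hr : IsRightReduced cs (commType cs e) x) :
    ∃ g ∈ Λ, IdemLE g f ∧ IdemLE g e ∧ x ∈ fixer g ∧ ∃ v, conj v g = f * conj x e := by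
  have hfi := h.idem_of_mem f hf
  have hci := isIdempotentElem_conj (h.idem_of_mem e he) x
  have hpi := h.factorisable.isIdempotentElem_mul hfi hci
  obtain ⟨g, hg, hgf, v, hv, hvg⟩ :=
    h.exists_conj_eq_of_idemLE hf hpi (h.factorisable.mul_idemLE_left hfi hci)
  have hpe : IdemLE (conj x⁻¹ (f * conj x e)) e := by
    have hle := (h.factorisable.mul_idemLE_right hfi hci).conj x⁻¹
    rwa [← conj_eq_iff_eq_conj_inv.1 rfl] at hle
  obtain ⟨g', hg', hge, u, hu, hug⟩ :=
    h.exists_conj_eq_of_idemLE he (isIdempotentElem_conj hpi x⁻¹) hpe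
  have hvxu : conj (v⁻¹ * (x * u)) g' = g := by
    rw [conj_mul, conj_mul x, hug, ← conj_mul x, mul_inv_cancel, conj_one, ← hvg, ← conj_mul,
      inv_mul_cancel, conj_one]
  obtain rfl := h.eq_of_conj_eq hg' hg hvxu
  obtain ⟨c, hc, b, hb, hcb⟩ :=
    h.exists_eq_mul_of_mem_centralizer hcs hg (mem_centralizer_iff_conj_eq.2 hvxu)
  have hcf : c ∈ centralizer f := h.parabolic_moveType_le hcs hf
    (parabolic_mono (h.moveType_mono hcs hg hf hgf) hc)
  refine ⟨g', hg, hgf, hge, ?_, v, hvg⟩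
  rw [h.fixer_eq hcs hg] at hb ⊢
  have hvc : v * c ∈ parabolic cs (commType cs f) := by
    rw [← h.centralizer_eq hcs hf]
    exact Subgroup.mul_mem _ hv hcf
  have huc : u⁻¹ ∈ parabolic cs (commType cs e) := by
    rw [← h.centralizer_eq hcs he]
    exact Subgroup.inv_mem _ hu
  refine mem_parabolic_of_double_reduced hl hr hvc hb huc ?_
  rw [mul_assoc v, ← hcb]
  group

theorem mul_mul_eq_of_reduced {e f : R} (he : e ∈ Λ) (hf : f ∈ Λ) {x : Rˣ}
    (hl : IsLeftReduced cs (commType cs f) x) (hr : IsRightReduced cs (commType cs e) x) :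
    ∃ g ∈ Λ, f * x * e = g ∧ IdemLE g f ∧ IdemLE g e ∧ x ∈ fixer g := by
  obtain ⟨g, hg, hgf, hge, hx, v, hv⟩ := h.exists_mem_fixer_conj_eq hcs he hf hl hr
  refine ⟨g, hg, ?_, hgf, hge, hx⟩
  have hgi := h.idem_of_mem g hg
  have hci := isIdempotentElem_conj (h.idem_of_mem e he) x
  have hpi := h.factorisable.isIdempotentElem_mul (h.idem_of_mem f hf) hci
  have hgp : g * (f * conj x e) = g := by
    rw [← mul_assoc, hgf.1, conj, ← mul_assoc, ← mul_assoc, hx.2, hge.1]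
    exact (inv_mem hx).2
  have hg_eq := h.eq_of_idemLE_of_conj_eq hg hpi (h.factorisable.idemLE_of_mul_eq hgi hpi hgp) hv
  calc f * x * e = f * conj x e * x := by simp [conj, mul_assoc]
    _ = g := by rw [← hg_eq, hx.2]

end IsSystem

end System

/-! ### Normal forms and the length -/

section Length

variable {R : Type*} [Monoid R] {Λ : Set R} {S : Set Rˣ} {M : CoxeterMatrix S}
  {cs : CoxeterSystem M Rˣ}

theorem wordVal_cons (x : Letter Λ S) (ω : List (Letter Λ S)) :
    wordVal (x :: ω) = x.val * wordVal ω := by simp [wordVal]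

theorem wordVal_append (ω ω' : List (Letter Λ S)) :
    wordVal (ω ++ ω') = wordVal ω * wordVal ω' := by simp [wordVal]

theorem wordLen_cons (x : Letter Λ S) (ω : List (Letter Λ S)) :
    wordLen (x :: ω) = x.len + wordLen ω := by simp [wordLen]

theorem wordLen_append (ω ω' : List (Letter Λ S)) :
    wordLen (ω ++ ω') = wordLen ω + wordLen ω' := by simp [wordLen]

theorem length_wordVal_le (ω : List (Letter Λ S)) : length Λ S (wordVal ω) ≤ wordLen ω :=
  Nat.sInf_le ⟨ω, rfl, rfl⟩

theorem length_eq_zero_of_mem {e : R} (he : e ∈ Λ) : length Λ S e = 0 := by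
  rw [← Nat.le_zero]
  by_cases h1 : e = 1
  · simpa [wordVal, wordLen, h1] using length_wordVal_le (Λ := Λ) (S := S) []
  · simpa [wordVal, wordLen, Letter.val, Letter.len] using
      length_wordVal_le (Λ := Λ) (S := S) [Sum.inr ⟨e, he, h1⟩]

theorem length_unit_le (hcs : ∀ s : S, cs.simple s = s) (u : Rˣ) :
    length Λ S (u : R) ≤ cs.length u := by
  obtain ⟨l, hl, rfl⟩ := cs.exists_isReduced u
  rw [hl.eq]
  clear hl
  suffices hword : wordVal (Λ := Λ) (l.map Sum.inl) = ((cs.wordProd l : Rˣ) : R) ∧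
      wordLen (Λ := Λ) (S := S) (l.map Sum.inl) = l.length by
    rw [← hword.1, ← hword.2]
    exact length_wordVal_le _
  induction l with
  | nil => simp [wordVal, wordLen]
  | cons i l ih =>
    rw [List.map_cons, wordVal_cons, wordLen_cons, ih.1, ih.2, cs.wordProd_cons, hcs]
    exact ⟨rfl, add_comm _ _⟩

/-- The expression `w₁ e w₂`, with `e ∈ Λ`, is the normal form of an element of `R`: here `w₁` is
the shortest element of `w₁ W_⋆(e)` and `w₂` is the shortest element of `W(e) w₂`. -/
structure IsNormalForm (Λ : Set R) (cs : CoxeterSystem M Rˣ) (w₁ : Rˣ) (e : R) (w₂ : Rˣ) :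
    Prop where
  mem : e ∈ Λ
  left : IsRightReduced cs (fixType cs e) w₁
  right : IsLeftReduced cs (commType cs e) w₂

theorem IsNormalForm.simple_mul {w₁ w₂ : Rˣ} {e : R} (hn : IsNormalForm Λ cs w₁ e w₂) (i : S) :
    IsNormalForm Λ cs (cs.simple i * w₁) e w₂ ∨
      ((cs.simple i * w₁ : Rˣ) : R) * e * w₂ = w₁ * e * w₂ := by
  rcases hn.left.simple_mul i with hl | ⟨j, hj, hij⟩
  · exact Or.inl ⟨hn.mem, hl, hn.right⟩
  · exact Or.inr (by rw [hij, mul_mul_unit_of_mem_fixer hj])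

theorem IsNormalForm.mul_simple {w₁ w₂ : Rˣ} {e : R} (hn : IsNormalForm Λ cs w₁ e w₂) (j : S) :
    IsNormalForm Λ cs w₁ e (w₂ * cs.simple j) ∨ (w₁ : R) * e * w₂ * cs.simple j = w₁ * e * w₂ ∨
      ∃ k ∈ moveType cs e, ∀ v : Rˣ,
        (v : R) * e * w₂ * cs.simple j = ((v * cs.simple k : Rˣ) : R) * e * w₂ := by
  rcases hn.right.mul_simple j with hr | ⟨k, hk, hjk⟩
  · exact Or.inl ⟨hn.mem, hn.left, hr⟩
  have hmove (v : Rˣ) :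
      (v : R) * e * w₂ * cs.simple j = ((v * cs.simple k : Rˣ) : R) * e * w₂ := by
    rw [mul_mul_unit_comm hk, ← hjk, Units.val_mul, mul_assoc _ (w₂ : R)]
  by_cases hf : k ∈ fixType cs e
  · exact Or.inr (Or.inl (by rw [hmove, mul_mul_unit_of_mem_fixer hf]))
  · exact Or.inr (Or.inr ⟨k, ⟨hk, hf⟩, hmove⟩)

namespace IsSystem

variable (h : IsSystem Λ S) (hcs : ∀ s : S, cs.simple s = s)

include h

theorem exists_minimal_word (r : R) :
    ∃ ω : List (Letter Λ S), wordVal ω = r ∧ wordLen ω = length Λ S r := by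
  obtain ⟨ω₀, h₀⟩ := h.exists_word r
  exact Nat.sInf_mem (s := {n | ∃ ω : List (Letter Λ S), wordVal ω = r ∧ wordLen ω = n})
    ⟨_, ω₀, h₀, rfl⟩

theorem length_mul_le_add (r r' : R) :
    length Λ S (r * r') ≤ length Λ S r + length Λ S r' := by
  obtain ⟨ω, hω, hl⟩ := h.exists_minimal_word r
  obtain ⟨ω', hω', hl'⟩ := h.exists_minimal_word r'
  rw [← hl, ← hl', ← wordLen_append, ← hω, ← hω', ← wordVal_append]
  exact length_wordVal_le _

include hcs

theorem length_mul_mul_le {e : R} (he : e ∈ Λ) (w₁ w₂ : Rˣ) :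
    length Λ S (w₁ * e * w₂) ≤ cs.length w₁ + cs.length w₂ := by
  have h₁₂ := h.length_mul_le_add (w₁ * e) w₂
  have h₁ := h.length_mul_le_add w₁ e
  have hw₁ := length_unit_le (Λ := Λ) hcs w₁
  have hw₂ := length_unit_le (Λ := Λ) hcs w₂
  rw [length_eq_zero_of_mem he] at h₁
  omega

theorem exists_normalForm_of_mul_mul {e : R} (he : e ∈ Λ) (v₁ v₂ : Rˣ) :
    ∃ w₁ w₂, IsNormalForm Λ cs w₁ e w₂ ∧ (v₁ : R) * e * v₂ = w₁ * e * w₂ ∧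
      cs.length w₁ + cs.length w₂ ≤ cs.length v₁ + cs.length v₂ := by
  obtain ⟨a, ha, w₂, rfl, hw₂⟩ := exists_mul_isLeftReduced cs (commType cs e) v₂
  have hlen₂ := hw₂.length_mul ha
  rw [← h.centralizer_eq hcs he] at ha
  obtain ⟨c, hc, b, hb, rfl⟩ := h.exists_eq_mul_of_mem_centralizer hcs he ha
  obtain ⟨w₁, d, hd, hw, hw₁⟩ := exists_isRightReduced_mul cs (fixType cs e) (v₁ * c)
  have hlen₁ := hw₁.length_mul hd
  rw [← hw] at hlen₁
  rw [← h.fixer_eq hcs he] at hd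
  refine ⟨w₁, w₂, ⟨he, hw₁, hw₂⟩, ?_, ?_⟩
  · rw [← mul_mul_unit_comm ha, ← mul_assoc, mul_mul_unit_of_mem_fixer hb, hw,
      mul_mul_unit_of_mem_fixer hd]
  · have hcb := h.length_mul_of_mem hcs he hc hb
    have hvc := cs.length_mul_le v₁ c
    omega

theorem normalForm_unique {e f : R} {w₁ w₂ v₁ v₂ : Rˣ} (hw : IsNormalForm Λ cs w₁ e w₂)
    (hv : IsNormalForm Λ cs v₁ f v₂) (heq : (w₁ : R) * e * w₂ = v₁ * f * v₂) :
    w₁ = v₁ ∧ e = f ∧ w₂ = v₂ := by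
  obtain ⟨rfl, ha, hab⟩ := h.eq_of_mul_mul_eq hw.mem hv.mem heq
  have hb : v₂ * w₂⁻¹ ∈ centralizer e :=
    (Subgroup.mul_mem_cancel_left _ ha).1 (fixer_le_centralizer e hab)
  rw [h.centralizer_eq hcs hw.mem] at hb
  have hb1 := hw.right.eq_one_of_mul hb (by rw [inv_mul_cancel_right]; exact hv.right)
  rw [hb1, mul_one, h.fixer_eq hcs hw.mem] at hab
  have ha1 := hw.left.eq_one_of_mul hab (by rw [mul_inv_cancel_left]; exact hv.left)
  exact ⟨inv_mul_eq_one.1 ha1, rfl, (mul_inv_eq_one.1 hb1).symm⟩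

theorem exists_eq_mul_mul_of_word (ω : List (Letter Λ S)) :
    ∃ e ∈ Λ, ∃ w₁ w₂ : Rˣ, wordVal ω = w₁ * e * w₂ ∧
      cs.length w₁ + cs.length w₂ ≤ wordLen ω := by
  induction ω with
  | nil => exact ⟨1, h.one_mem, 1, 1, by simp [wordVal], by simp⟩
  | cons x ω ih =>
    obtain ⟨e, he, w₁, w₂, hω, hle⟩ := ih
    rw [wordVal_cons, wordLen_cons, hω]
    rcases x with s | ⟨f, hf, -⟩
    · refine ⟨e, he, cs.simple s * w₁, w₂, by simp only [hcs, Letter.val, Units.val_mul, mul_assoc],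
        ?_⟩
      have hsw := cs.length_mul_le (cs.simple s) w₁
      rw [cs.length_simple] at hsw
      rw [Letter.len]
      omega
    · obtain ⟨a, ha, y, rfl, hy⟩ := exists_mul_isLeftReduced cs (commType cs f) w₁
      have hlen := hy.length_mul ha
      obtain ⟨x, b, hb, rfl, hx⟩ := exists_isRightReduced_mul cs (commType cs e) y
      have hlen' := hx.length_mul hb
      obtain ⟨g, hg, hfxe, -, -, -⟩ := h.mul_mul_eq_of_reduced hcs he hf (hy.of_mul hlen') hx
      rw [← h.centralizer_eq hcs hf] at ha
      rw [← h.centralizer_eq hcs he] at hb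
      have ha : (a : R) * f = f * a := ha
      refine ⟨g, hg, a, b * w₂, ?_, ?_⟩
      · rw [← mul_assoc a, mul_mul_unit_comm hb]
        simp only [Letter.val, Units.val_mul, ← hfxe, ← mul_assoc, ← ha]
      · have hbw := cs.length_mul_le b w₂
        rw [Letter.len]
        omega

theorem exists_normalForm (r : R) : ∃ w₁ e w₂, IsNormalForm Λ cs w₁ e w₂ ∧
    r = w₁ * e * w₂ ∧ cs.length w₁ + cs.length w₂ = length Λ S r := by
  obtain ⟨ω, rfl, hω⟩ := h.exists_minimal_word r
  obtain ⟨e, he, v₁, v₂, hv, hle⟩ := h.exists_eq_mul_mul_of_word hcs ω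
  obtain ⟨w₁, w₂, hn, hvw, hle'⟩ := h.exists_normalForm_of_mul_mul hcs he v₁ v₂
  have hle'' := h.length_mul_mul_le hcs he w₁ w₂
  rw [← hvw, ← hv] at hle''
  exact ⟨w₁, e, w₂, hn, hv.trans hvw, by omega⟩

theorem length_normalForm {w₁ w₂ : Rˣ} {e : R} (hn : IsNormalForm Λ cs w₁ e w₂) :
    length Λ S (w₁ * e * w₂) = cs.length w₁ + cs.length w₂ := by
  obtain ⟨v₁, f, v₂, hv, heq, hlen⟩ := h.exists_normalForm hcs (w₁ * e * w₂)
  obtain ⟨rfl, -, rfl⟩ := h.normalForm_unique hcs hn hv heq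
  exact hlen.symm

omit h in
theorem exists_simple_eq {s : Rˣ} (hs : s ∈ S) : ∃ i, cs.simple i = s :=
  ⟨⟨s, hs⟩, hcs _⟩

omit hcs

theorem sq_eq_one {s : Rˣ} (hs : s ∈ S) : s * s = 1 := by
  obtain ⟨M, cs, hcs⟩ := h.coxeter
  obtain ⟨i, rfl⟩ := exists_simple_eq hcs hs
  exact cs.simple_mul_simple_self i

theorem mul_mul_cancel {s : Rˣ} (hs : s ∈ S) (r : R) : (s : R) * (s * r) = r := by
  rw [← mul_assoc, ← Units.val_mul, h.sq_eq_one hs, Units.val_one, one_mul]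

theorem length_mul_cases {s : Rˣ} (hs : s ∈ S) (r : R) :
    length Λ S (s * r) = length Λ S r + 1 ∨ length Λ S (s * r) + 1 = length Λ S r ∨
      s * r = r := by
  obtain ⟨M, cs, hcs⟩ := h.coxeter
  obtain ⟨i, rfl⟩ := exists_simple_eq hcs hs
  obtain ⟨w₁, e, w₂, hn, rfl, -⟩ := h.exists_normalForm hcs r
  rw [← mul_assoc, ← mul_assoc, ← Units.val_mul]
  rcases hn.simple_mul i with hsn | hfix
  · rw [h.length_normalForm hcs hn, h.length_normalForm hcs hsn]
    rcases cs.length_simple_mul w₁ i with hlen | hlen <;> omega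
  · exact Or.inr (Or.inr hfix)

theorem length_generator {s : Rˣ} (hs : s ∈ S) : length Λ S (s : R) = 1 := by
  obtain ⟨M, cs, hcs⟩ := h.coxeter
  obtain ⟨i, rfl⟩ := exists_simple_eq hcs hs
  have hcases := h.length_mul_cases hs 1
  rw [mul_one, length_eq_zero_of_mem h.one_mem] at hcases
  rcases hcases with hlen | hlen | hone
  · exact hlen
  · omega
  · have hlen := cs.length_simple i
    rw [Units.val_eq_one.1 hone, cs.length_one] at hlen
    omega

theorem mul_eq_mul_of_length_mul_mul {s t : Rˣ} (hs : s ∈ S) (ht : t ∈ S) {r : R}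
    (hsr : length Λ S (s * r) = length Λ S r + 1) (hrt : length Λ S (r * t) = length Λ S r + 1)
    (hsrt : length Λ S (s * r * t) = length Λ S r) : s * r = r * t := by
  obtain ⟨M, cs, hcs⟩ := h.coxeter
  obtain ⟨i, rfl⟩ := exists_simple_eq hcs hs
  obtain ⟨j, rfl⟩ := exists_simple_eq hcs ht
  obtain ⟨w₁, e, w₂, hn, rfl, -⟩ := h.exists_normalForm hcs r
  have hassoc : (cs.simple i : R) * (w₁ * e * w₂) = ((cs.simple i * w₁ : Rˣ) : R) * e * w₂ := by
    simp only [Units.val_mul, mul_assoc]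
  rw [hassoc] at hsr hsrt ⊢
  have hlen := h.length_normalForm hcs hn
  rcases hn.simple_mul i with hsn | hfix
  swap
  · rw [hfix] at hsr
    omega
  have hlen_s := h.length_normalForm hcs hsn
  rcases hn.mul_simple j with hnt | hfix | ⟨k, hk, hjk⟩
  · have hlen_t := h.length_normalForm hcs hnt
    have hlen_st := h.length_normalForm hcs ⟨hn.mem, hsn.left, hnt.right⟩
    rw [Units.val_mul w₂, ← mul_assoc] at hlen_t hlen_st
    omega
  · rw [hfix] at hrt
    omega
  · have hk' := simple_mem_parabolic (cs := cs) hk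
    have hlen_t := h.length_normalForm hcs
      ⟨hn.mem, h.isRightReduced_mul hcs hn.mem hn.left hk', hn.right⟩
    have hlen_st := h.length_normalForm hcs
      ⟨hn.mem, h.isRightReduced_mul hcs hn.mem hsn.left hk', hn.right⟩
    rw [← hjk] at hlen_t hlen_st
    rw [hjk, simple_mul_eq_mul_simple (cs := cs)]
    · rw [cs.not_isLeftDescent_iff]; omega
    · rw [cs.not_isRightDescent_iff]; omega
    · omega

theorem exists_mul_mul_eq (hcs : ∀ s : S, cs.simple s = s) {e f : R} (he : e ∈ Λ) (hf : f ∈ Λ)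
    {w : Rˣ} (hw : IsLeftReduced cs (commType cs e) w) :
    ∃ g ∈ Λ, ∃ y : Rˣ, IsLeftReduced cs (commType cs g) y ∧ e * w * f = g * y := by
  obtain ⟨x, b, hb, rfl, hx⟩ := exists_isRightReduced_mul cs (commType cs f) w
  have hlen := hx.length_mul hb
  obtain ⟨g, hg, hexf, hge, -, hxg⟩ := h.mul_mul_eq_of_reduced hcs hf he (hw.of_mul hlen) hx
  rw [← h.centralizer_eq hcs hf] at hb
  obtain ⟨c, hc, y, rfl, hy⟩ := exists_mul_isLeftReduced cs (commType cs g) b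
  have hlen' := hy.length_mul hc
  rw [← h.centralizer_eq hcs hg] at hc
  obtain ⟨p, hp, d, hd, rfl⟩ := h.exists_eq_mul_of_mem_centralizer hcs hg hc
  have hpe : p ∈ parabolic cs (commType cs e) := by
    rw [← h.centralizer_eq hcs he]
    exact h.parabolic_moveType_le hcs he (parabolic_mono (h.moveType_mono hcs hg he hge) hp)
  have hw' : x * (p * d * y) = p * (x * (d * y)) := by
    rw [mul_assoc p, ← mul_assoc x, h.mul_comm_of_mem hcs hg hxg hp, mul_assoc]
  have hp1 : p = 1 := by
    have hlen_inv := hw.length_mul (Subgroup.inv_mem _ hpe)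
    rw [hw', inv_mul_cancel_left, cs.length_inv, ← hw', hlen, hlen',
      h.length_mul_of_mem hcs hg hp hd] at hlen_inv
    have hle := cs.length_mul_le x (d * y)
    have hle' := cs.length_mul_le d y
    rw [← cs.length_eq_zero_iff]
    omega
  rw [hp1, one_mul] at hb ⊢
  have hb : ((d * y : Rˣ) : R) * f = f * ((d * y : Rˣ) : R) := hb
  refine ⟨g, hg, y, hy, ?_⟩
  calc e * ((x * (d * y) : Rˣ) : R) * f = e * x * f * ((d * y : Rˣ) : R) := by
        rw [Units.val_mul x, mul_assoc, mul_assoc (x : R), hb, ← mul_assoc, ← mul_assoc]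
    _ = g * y := by rw [hexf, Units.val_mul, ← mul_assoc, hd.2]

theorem length_mul_le_length_mul_mul {s : Rˣ} (hs : s ∈ S) {f : R} (hf : f ∈ Λ) {r : R}
    (hr : length Λ S r < length Λ S (s * r)) :
    length Λ S (r * f) ≤ length Λ S (s * (r * f)) := by
  obtain ⟨M, cs, hcs⟩ := h.coxeter
  obtain ⟨i, rfl⟩ := exists_simple_eq hcs hs
  obtain ⟨w₁, e, w₂, hn, rfl, -⟩ := h.exists_normalForm hcs r
  obtain ⟨g, hg, y, hy, heg⟩ := h.exists_mul_mul_eq hcs hn.mem hf hn.right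
  obtain ⟨z, k, hk, rfl, hz⟩ := exists_isRightReduced_mul cs (fixType cs g) w₁
  have hzk := hz.length_mul hk
  rw [← h.fixer_eq hcs hg] at hk
  have hrf : ((z * k : Rˣ) : R) * e * w₂ * f = z * g * y := by
    rw [mul_assoc _ e, mul_assoc, heg, ← mul_assoc, mul_mul_unit_of_mem_fixer hk]
  rw [hrf, ← mul_assoc, ← mul_assoc, ← Units.val_mul]
  have hzn : IsNormalForm Λ cs z g y := ⟨hg, hz, hy⟩
  rcases hzn.simple_mul i with hsn | hfix
  · rw [h.length_normalForm hcs hsn, h.length_normalForm hcs hzn]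
    by_contra! hlt
    have hle := h.length_mul_mul_le hcs hn.mem (cs.simple i * (z * k)) w₂
    have hle' := cs.length_mul_le (cs.simple i * z) k
    rw [h.length_normalForm hcs hn, ← mul_assoc, ← mul_assoc, ← Units.val_mul] at hr
    rw [mul_assoc (cs.simple i)] at hle'
    omega
  · rw [hfix]

end IsSystem

end Length

/-! ### The inverse monoid structure -/

section Inverse

variable {R : Type*} [Monoid R] {Λ : Set R} {S : Set Rˣ}

namespace IsFactorisable

variable (hR : IsFactorisable R)

include hR

theorem exists_inverse (r : R) : ∃ r', r * r' * r = r ∧ r' * r * r' = r' := by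
  obtain ⟨e, u, he, rfl⟩ := hR.eq_idem_mul_unit r
  refine ⟨((u⁻¹ : Rˣ) : R) * e, ?_, ?_⟩
  · calc e * u * (((u⁻¹ : Rˣ) : R) * e) * (e * u) = e * (e * e) * u := by
          simp only [mul_assoc, Units.mul_inv_cancel_left]
      _ = e * u := by rw [he.eq, he.eq]
  · simp only [mul_assoc, Units.mul_inv_cancel_left]
    rw [← mul_assoc e e, he.eq, he.eq]

/-- The inverse of `r` in the sense of inverse semigroups: the unique `r'` with `r r' r = r` and
`r' r r' = r'`. It plays the role of the anti-automorphism of `R` that inverts the units and fixes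
the idempotents. -/
noncomputable def inverse (r : R) : R := (hR.exists_inverse r).choose

theorem mul_inverse_mul (r : R) : r * hR.inverse r * r = r :=
  (hR.exists_inverse r).choose_spec.1

theorem inverse_mul_inverse (r : R) : hR.inverse r * r * hR.inverse r = hR.inverse r :=
  (hR.exists_inverse r).choose_spec.2

omit hR in
theorem isIdempotentElem_of_mul_mul_eq {r r' : R} (hr : r * r' * r = r) :
    IsIdempotentElem (r * r') := by
  rw [IsIdempotentElem, ← mul_assoc, hr]

theorem inverse_unique {r a b : R} (ha : r * a * r = r) (ha' : a * r * a = a)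
    (hb : r * b * r = r) (hb' : b * r * b = b) : a = b := by
  have har := hR.idem_comm _ _ (isIdempotentElem_of_mul_mul_eq ha')
    (isIdempotentElem_of_mul_mul_eq hb')
  have hra := hR.idem_comm _ _ (isIdempotentElem_of_mul_mul_eq ha)
    (isIdempotentElem_of_mul_mul_eq hb)
  calc a = a * r * (b * r) * a := by
        rw [← mul_assoc, mul_assoc a, mul_assoc a, hb, ha']
    _ = b * r * a := by rw [har, mul_assoc, ha']
    _ = b * (r * b * (r * a)) := by rw [← mul_assoc (r * b), hb, mul_assoc]
    _ = b := by rw [← hra, ← mul_assoc (r * a), ha, ← mul_assoc, hb']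

theorem inverse_eq {r r' : R} (hr : r * r' * r = r) (hr' : r' * r * r' = r') :
    hR.inverse r = r' :=
  hR.inverse_unique (hR.mul_inverse_mul r) (hR.inverse_mul_inverse r) hr hr'

theorem inverse_inverse (r : R) : hR.inverse (hR.inverse r) = r :=
  hR.inverse_eq (hR.inverse_mul_inverse r) (hR.mul_inverse_mul r)

theorem inverse_idem {e : R} (he : IsIdempotentElem e) : hR.inverse e = e :=
  hR.inverse_eq (by rw [he.eq, he.eq]) (by rw [he.eq, he.eq])

theorem inverse_unit (u : Rˣ) : hR.inverse (u : R) = ((u⁻¹ : Rˣ) : R) :=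
  hR.inverse_eq (by simp) (by simp)

theorem inverse_mul (r r' : R) : hR.inverse (r * r') = hR.inverse r' * hR.inverse r := by
  have hcomm := hR.idem_comm _ _ (isIdempotentElem_of_mul_mul_eq (hR.mul_inverse_mul r'))
    (isIdempotentElem_of_mul_mul_eq (hR.inverse_mul_inverse r))
  refine hR.inverse_eq ?_ ?_
  · calc r * r' * (hR.inverse r' * hR.inverse r) * (r * r')
        = r * (r' * hR.inverse r' * (hR.inverse r * r)) * r' := by simp only [mul_assoc]
      _ = r * hR.inverse r * r * (r' * hR.inverse r' * r') := by
        rw [hcomm]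
        simp only [mul_assoc]
      _ = r * r' := by rw [hR.mul_inverse_mul, hR.mul_inverse_mul]
  · calc hR.inverse r' * hR.inverse r * (r * r') * (hR.inverse r' * hR.inverse r)
        = hR.inverse r' * (hR.inverse r * r * (r' * hR.inverse r')) * hR.inverse r := by
          simp only [mul_assoc]
      _ = hR.inverse r' * r' * hR.inverse r' * (hR.inverse r * r * hR.inverse r) := by
        rw [← hcomm]
        simp only [mul_assoc]
      _ = hR.inverse r' * hR.inverse r := by
        rw [hR.inverse_mul_inverse, hR.inverse_mul_inverse]

end IsFactorisable

namespace IsSystem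

variable (h : IsSystem Λ S)

include h

theorem inverse_simple {s : Rˣ} (hs : s ∈ S) : h.factorisable.inverse (s : R) = s := by
  rw [h.factorisable.inverse_unit, inv_eq_of_mul_eq_one_right (h.sq_eq_one hs)]

theorem inverse_val (x : Letter Λ S) : h.factorisable.inverse x.val = x.val := by
  rcases x with ⟨s, hs⟩ | ⟨e, he, -⟩
  · exact h.inverse_simple hs
  · exact h.factorisable.inverse_idem (h.idem_of_mem e he)

theorem inverse_wordVal (ω : List (Letter Λ S)) :
    h.factorisable.inverse (wordVal ω) = wordVal ω.reverse := by
  induction ω with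
  | nil => exact h.factorisable.inverse_idem IsIdempotentElem.one
  | cons x ω ih =>
    rw [List.reverse_cons, wordVal_append, wordVal_cons, h.factorisable.inverse_mul, ih,
      h.inverse_val, wordVal_cons, show wordVal ([] : List (Letter Λ S)) = 1 from rfl, mul_one]

theorem length_inverse (r : R) : length Λ S (h.factorisable.inverse r) = length Λ S r := by
  suffices hle : ∀ r, length Λ S (h.factorisable.inverse r) ≤ length Λ S r from
    le_antisymm (hle r) <| by
      simpa only [h.factorisable.inverse_inverse] using hle (h.factorisable.inverse r)
  intro r
  obtain ⟨ω, rfl, hω⟩ := h.exists_minimal_word r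
  have hrev : wordLen ω.reverse = wordLen ω := by simp [wordLen]
  rw [← hω, ← hrev, h.inverse_wordVal]
  exact length_wordVal_le _

theorem inverse_mul_simple {t : Rˣ} (ht : t ∈ S) (r : R) :
    h.factorisable.inverse (r * t) = t * h.factorisable.inverse r := by
  rw [h.factorisable.inverse_mul, h.inverse_simple ht]

theorem inverse_simple_mul {s : Rˣ} (hs : s ∈ S) (r : R) :
    h.factorisable.inverse (s * r) = h.factorisable.inverse r * s := by
  rw [h.factorisable.inverse_mul, h.inverse_simple hs]

theorem mul_mul_cancel_right {s : Rˣ} (hs : s ∈ S) (r : R) : r * (s : R) * s = r := by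
  rw [mul_assoc, ← Units.val_mul, h.sq_eq_one hs, Units.val_one, mul_one]

theorem length_mul_simple_le {t : Rˣ} (ht : t ∈ S) (r : R) :
    length Λ S (r * t) ≤ length Λ S r + 1 := by
  simpa only [h.length_generator ht] using h.length_mul_le_add r t

theorem mul_eq_self_of_length_eq {s : Rˣ} (hs : s ∈ S) {r : R}
    (hr : length Λ S (s * r) = length Λ S r) : s * r = r := by
  rcases h.length_mul_cases hs r with hup | hdown | hfix
  · omega
  · omega
  · exact hfix

theorem length_lt_length_mul_mul_simple {s t : Rˣ} (hs : s ∈ S) (ht : t ∈ S) {r : R}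
    (hr : length Λ S r < length Λ S (s * r)) (hne : s * r ≠ r * t) :
    length Λ S (r * t) < length Λ S (s * (r * t)) := by
  have hup : length Λ S (s * r) = length Λ S r + 1 := by
    rcases h.length_mul_cases hs r with hup | hdown | hfix
    · exact hup
    · omega
    · exact absurd hr (by rw [hfix]; exact lt_irrefl _)
  have hrt := h.length_mul_simple_le ht r
  have hsrt := h.length_mul_simple_le ht (s * r * t)
  rw [h.mul_mul_cancel_right ht] at hsrt
  rcases h.length_mul_cases hs (r * t) with hup' | hdown' | hfix'
  · omega
  · rw [← mul_assoc] at hdown'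
    exact absurd (h.mul_eq_mul_of_length_mul_mul hs ht hup (by omega) (by omega)) hne
  · have hsr : s * r = r := by
      rw [← h.mul_mul_cancel_right ht (s * r), mul_assoc (s : R), hfix', h.mul_mul_cancel_right ht]
    exact absurd hr (by rw [hsr]; exact lt_irrefl _)

theorem mul_eq_mul_or_cmp_length_eq {s t : Rˣ} (hs : s ∈ S) (ht : t ∈ S) (r : R) :
    s * r = r * t ∨ cmp (length Λ S (r * t)) (length Λ S (s * (r * t))) =
      cmp (length Λ S r) (length Λ S (s * r)) := by
  refine or_iff_not_imp_left.2 fun hne => ?_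
  rcases lt_trichotomy (length Λ S r) (length Λ S (s * r)) with hr | hr | hr
  · rw [hr.cmp_eq_lt, (h.length_lt_length_mul_mul_simple hs ht hr hne).cmp_eq_lt]
  · rw [← mul_assoc, h.mul_eq_self_of_length_eq hs hr.symm]
    simp only [cmp_self_eq_eq]
  · have hne' : s * (s * r) ≠ s * r * t := fun heq => hne <| by
      rw [← h.mul_mul_cancel hs (r * t), ← mul_assoc (s : R) r, ← heq, h.mul_mul_cancel hs]
    have hlt := h.length_lt_length_mul_mul_simple hs ht (by rwa [h.mul_mul_cancel hs]) hne'
    rw [mul_assoc, h.mul_mul_cancel hs] at hlt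
    rw [hr.cmp_eq_gt, hlt.cmp_eq_gt]

theorem mul_eq_mul_or_cmp_length_mul_eq {s t : Rˣ} (hs : s ∈ S) (ht : t ∈ S) (r : R) :
    s * r = r * t ∨ cmp (length Λ S (s * r)) (length Λ S (s * (r * t))) =
      cmp (length Λ S r) (length Λ S (r * t)) := by
  have hinv := h.mul_eq_mul_or_cmp_length_eq ht hs (h.factorisable.inverse r)
  simp only [← h.inverse_mul_simple ht, ← h.inverse_simple_mul hs, h.length_inverse,
    mul_assoc] at hinv
  refine hinv.imp_left fun heq => ?_
  simpa only [h.factorisable.inverse_inverse] using (congrArg h.factorisable.inverse heq).symm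

theorem mul_mul_eq_or_cmp_length_eq {s : Rˣ} (hs : s ∈ S) {f : R} (hf : f ∈ Λ) (r : R) :
    s * (r * f) = r * f ∨ cmp (length Λ S (r * f)) (length Λ S (s * (r * f))) =
      cmp (length Λ S r) (length Λ S (s * r)) := by
  refine or_iff_not_imp_left.2 fun hne => ?_
  have hne' : length Λ S (s * (r * f)) ≠ length Λ S (r * f) :=
    fun heq => hne (h.mul_eq_self_of_length_eq hs heq)
  rcases lt_trichotomy (length Λ S r) (length Λ S (s * r)) with hr | hr | hr
  · rw [hr.cmp_eq_lt, ((h.length_mul_le_length_mul_mul hs hf hr).lt_of_ne' hne').cmp_eq_lt]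
  · rw [← mul_assoc, h.mul_eq_self_of_length_eq hs hr.symm]
    simp only [cmp_self_eq_eq]
  · have hle := h.length_mul_le_length_mul_mul hs hf (r := s * r) (by rwa [h.mul_mul_cancel hs])
    rw [mul_assoc, h.mul_mul_cancel hs] at hle
    rw [hr.cmp_eq_gt, (hle.lt_of_ne hne').cmp_eq_gt]

theorem length_mul_idem_le {f : R} (hf : f ∈ Λ) (r : R) :
    length Λ S (r * f) ≤ length Λ S r := by
  simpa only [length_eq_zero_of_mem hf, add_zero] using h.length_mul_le_add r f

theorem length_sub_length_mul_eq {s : Rˣ} (hs : s ∈ S) {f : R} (hf : f ∈ Λ) {r : R}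
    (hne : s * (r * f) ≠ r * f) :
    length Λ S (s * r) - length Λ S (s * (r * f)) = length Λ S r - length Λ S (r * f) := by
  have hcmp := (h.mul_mul_eq_or_cmp_length_eq hs hf r).resolve_left hne
  have hlt := lt_iff_lt_of_cmp_eq_cmp hcmp
  have hr := (h.length_mul_cases hs r).imp_right fun hr =>
    hr.resolve_right fun heq => hne (by rw [← mul_assoc, heq])
  have hrf := (h.length_mul_cases hs (r * f)).imp_right fun hrf => hrf.resolve_right hne
  omega

end IsSystem

end Inverse

/-! ### Products on a free module -/

section FreeModule

open MulOpposite

variable {R : Type*} {A : Type*} [Ring A]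

theorem smul_T (a : A) (r : R) : a • T A r = Finsupp.single r a := by
  rw [T, Finsupp.smul_single, smul_eq_mul, mul_one]

theorem op_smul_T (a : A) (r : R) : op a • T A r = a • T A r := by
  rw [smul_T, T, Finsupp.smul_single, op_smul_eq_mul, one_mul]

theorem op_smul_smul_T {K : Type*} [CommRing K] [Algebra K A] (k : K) (a : A) (r : R) :
    op a • k • T A r = a • k • T A r := by
  rw [smul_comm, op_smul_T, smul_comm]

theorem linearCombination_T (f : R → (R →₀ A)) (r : R) :
    Finsupp.linearCombination A f (T A r) = f r := by
  rw [T, Finsupp.linearCombination_single, one_smul]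

theorem induction_T {p : (R →₀ A) → Prop} (x : R →₀ A) (zero : p 0)
    (add : ∀ x y, p x → p y → p (x + y)) (smul : ∀ (a : A) (r : R), p (a • T A r)) : p x := by
  induction x using Finsupp.induction_linear with
  | zero => exact zero
  | add x y hx hy => exact add x y hx hy
  | single r a => rw [← smul_T]; exact smul a r

theorem linearMap_ext_T {f g : (R →₀ A) →ₗ[A] (R →₀ A)} (hfg : ∀ r, f (T A r) = g (T A r)) :
    f = g :=
  Finsupp.lhom_ext fun r a => by rw [← smul_T, map_smul, map_smul, hfg]

theorem linearCombination_op_smul {f : R → (R →₀ A)} (hf : ∀ r (a : A), op a • f r = a • f r)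
    (a : A) (x : R →₀ A) :
    Finsupp.linearCombination A f (op a • x) = op a • Finsupp.linearCombination A f x := by
  induction x using induction_T with
  | zero => simp
  | add x y hx hy => rw [smul_add, map_add, map_add, smul_add, hx, hy]
  | smul b r => rw [smul_comm (op a) b, map_smul, op_smul_T, map_smul, linearCombination_T,
      map_smul, linearCombination_T, smul_comm (op a) b, hf]

/-- The left linear product on the free module with basis `(T_r)` in which left multiplication by
`T_r` is the operator `L r`. -/
noncomputable def mulOfLeft (L : R → Module.End A (R →₀ A)) : (R →₀ A) →+ (R →₀ A) →+ (R →₀ A) :=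
  Finsupp.liftAddHom fun r => (smulAddHom A (R →₀ A)).compl₂ (L r).toAddMonoidHom

variable {L L' : R → Module.End A (R →₀ A)}

theorem mulOfLeft_smul_T (a : A) (r : R) (y : R →₀ A) :
    mulOfLeft L (a • T A r) y = a • L r y := by
  rw [smul_T, mulOfLeft, Finsupp.liftAddHom_apply_single]
  rfl

theorem mulOfLeft_smul (a : A) (x y : R →₀ A) :
    mulOfLeft L (a • x) y = a • mulOfLeft L x y := by
  induction x using induction_T with
  | zero => simp
  | add x x' hx hx' => simp only [smul_add, map_add, AddMonoidHom.add_apply, hx, hx']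
  | smul b r => rw [smul_smul, mulOfLeft_smul_T, mulOfLeft_smul_T, smul_smul]

theorem mulOfLeft_smul_middle (a : A) (x y : R →₀ A) :
    mulOfLeft L (op a • x) y = mulOfLeft L x (a • y) := by
  induction x using induction_T with
  | zero => simp
  | add x x' hx hx' => simp only [smul_add, map_add, AddMonoidHom.add_apply, hx, hx']
  | smul b r =>
    rw [smul_comm, op_smul_T, smul_smul, mulOfLeft_smul_T, mulOfLeft_smul_T, map_smul, smul_smul]

theorem mulOfLeft_op_smul (hop : ∀ r (a : A) v, L r (op a • v) = op a • L r v) (a : A)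
    (x y : R →₀ A) : mulOfLeft L x (op a • y) = op a • mulOfLeft L x y := by
  induction x using induction_T with
  | zero => simp
  | add x x' hx hx' => simp only [smul_add, map_add, AddMonoidHom.add_apply, hx, hx']
  | smul b r => rw [mulOfLeft_smul_T, mulOfLeft_smul_T, hop, smul_comm]

theorem mulOfLeft_apply_of_commute {f : Module.End A (R →₀ A)} (hf : ∀ r, Commute (L r) f)
    (x y : R →₀ A) : mulOfLeft L x (f y) = f (mulOfLeft L x y) := by
  induction x using induction_T with
  | zero => simp
  | add x x' hx hx' => simp only [map_add, AddMonoidHom.add_apply, hx, hx']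
  | smul b r =>
    rw [mulOfLeft_smul_T, mulOfLeft_smul_T, map_smul]
    exact congrArg _ (LinearMap.congr_fun (hf r).eq y)

theorem mulOfLeft_T_one {o : R} (hL : ∀ r, L r (T A o) = T A r) (x : R →₀ A) :
    mulOfLeft L x (T A o) = x := by
  induction x using induction_T with
  | zero => simp
  | add x x' hx hx' => rw [map_add, AddMonoidHom.add_apply, hx, hx']
  | smul b r => rw [mulOfLeft_smul_T, hL]

theorem mulOfLeft_apply_T {o : R} (hL : ∀ r, L r (T A o) = T A r)
    (hL' : ∀ r, L' r (T A o) = T A r) (hcomm : ∀ r r', Commute (L r) (L' r')) (x : R →₀ A)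
    (r : R) : mulOfLeft L x (T A r) = L' r x := by
  rw [← hL', mulOfLeft_apply_of_commute fun r' => hcomm r' r, mulOfLeft_T_one hL]

/-- Commuting families `L` and `L'` that both map `T_o` to `T_r` are forced to be the left and the
right multiplications, and associativity is their commutation. -/
theorem isAlgebraMul_mulOfLeft {o : R} (hL : ∀ r, L r (T A o) = T A r)
    (hL' : ∀ r, L' r (T A o) = T A r) (hcomm : ∀ r r', Commute (L r) (L' r'))
    (hop : ∀ r (a : A) v, L r (op a • v) = op a • L r v) :
    IsAlgebraMul (T A o) (mulOfLeft L) where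
  one_mul x := by
    induction x using induction_T with
    | zero => simp
    | add x x' hx hx' => rw [map_add, hx, hx']
    | smul a r =>
      rw [← mulOfLeft_smul_middle, op_smul_T, mulOfLeft_smul, mulOfLeft_apply_T hL hL' hcomm, hL']
  mul_one := mulOfLeft_T_one hL
  mul_assoc x y z := by
    induction z using induction_T with
    | zero => simp
    | add z z' hz hz' => simp only [map_add, hz, hz']
    | smul c r =>
      have hT := mulOfLeft_apply_T hL hL' hcomm
      rw [← mulOfLeft_smul_middle, ← mulOfLeft_smul_middle, hT, hT,
        mulOfLeft_apply_of_commute fun r' => hcomm r' r, mulOfLeft_op_smul hop]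
  smul_mul := mulOfLeft_smul
  smul_middle := mulOfLeft_smul_middle
  mul_smul := mulOfLeft_op_smul hop

theorem eq_mulOfLeft {mul : (R →₀ A) →+ (R →₀ A) →+ (R →₀ A)}
    (hsmul : ∀ (a : A) (x y), mul (a • x) y = a • mul x y)
    (hmul : ∀ r y, mul (T A r) y = L r y) : mul = mulOfLeft L := by
  refine AddMonoidHom.ext fun x => AddMonoidHom.ext fun y => ?_
  induction x using induction_T with
  | zero => simp
  | add x x' hx hx' => simp only [map_add, AddMonoidHom.add_apply, hx, hx']
  | smul a r => rw [hsmul, hmul, mulOfLeft_smul_T]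

end FreeModule

/-! ### The Hecke operators -/

section Operators

open MulOpposite

variable {R : Type*} [Monoid R] {Λ : Set R} {S : Set Rˣ}
variable {K : Type*} [CommRing K] (A : Type*) [Ring A] [Algebra K A] (q : K)

/-- The coefficient of `T_r` in `T_s T_r`, in terms of the comparison of `ℓ(r)` with `ℓ(sr)`. When
the lengths agree, `sr = r`, and the term `q T_r` is accounted for by `moveCoeff`. -/
def stayCoeff : Ordering → K
  | .lt => 0
  | .eq => 0
  | .gt => q - 1

/-- The coefficient of `T_{sr}` in `T_s T_r`, in terms of the comparison of `ℓ(r)` with `ℓ(sr)`. -/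
def moveCoeff : Ordering → K
  | .lt => 1
  | .eq => q
  | .gt => q

/-- The prescribed value of `T_x T_r` for a letter `x`. The parameter lives in a commutative ring
`K` of scalars of `A`, over which the operators below are linear. -/
noncomputable def leftVal : Letter Λ S → R → (R →₀ A)
  | Sum.inl s, r =>
    stayCoeff q (cmp (length Λ S r) (length Λ S ((s : Rˣ) * r))) • T A r +
      moveCoeff q (cmp (length Λ S r) (length Λ S ((s : Rˣ) * r))) • T A ((s : Rˣ) * r)
  | Sum.inr e, r => q ^ (length Λ S r - length Λ S (e * r)) • T A (e * r)

variable {A q} in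
theorem leftVal_of_gt {s : S} {r : R} (hr : length Λ S ((s : Rˣ) * r) = length Λ S r + 1) :
    leftVal A q (Sum.inl s : Letter Λ S) r = T A ((s : Rˣ) * r) := by
  rw [leftVal, LT.lt.cmp_eq_lt (by omega), stayCoeff, moveCoeff, zero_smul, zero_add, one_smul]

variable {A q} in
theorem leftVal_of_lt {s : S} {r : R} (hr : length Λ S ((s : Rˣ) * r) + 1 = length Λ S r) :
    leftVal A q (Sum.inl s : Letter Λ S) r =
      (algebraMap K A q - 1) • T A r + algebraMap K A q • T A ((s : Rˣ) * r) := by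
  rw [leftVal, LT.lt.cmp_eq_gt (by omega), stayCoeff, moveCoeff, algebraMap_smul, sub_smul,
    sub_smul, algebraMap_smul, one_smul, one_smul]

variable {A q} in
theorem leftVal_of_mul_eq {s : S} {r : R} (hr : (s : Rˣ) * r = r) :
    leftVal A q (Sum.inl s : Letter Λ S) r = algebraMap K A q • T A r := by
  rw [leftVal, hr, cmp_self_eq_eq, stayCoeff, moveCoeff, zero_smul, zero_add, algebraMap_smul]

variable {A q} in
theorem leftVal_idem {e : (Λ \ {1} : Set R)} {r : R} :
    leftVal A q (Sum.inr e : Letter Λ S) r =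
      algebraMap K A q ^ (length Λ S r - length Λ S (e * r)) • T A (e * r) := by
  rw [leftVal, ← map_pow, algebraMap_smul]

/-- The operator of left multiplication by `T_x` for a letter `x`. -/
noncomputable def leftOp (x : Letter Λ S) : Module.End A (R →₀ A) :=
  Finsupp.linearCombination A (leftVal A q x)

theorem leftOp_T (x : Letter Λ S) (r : R) : leftOp A q x (T A r) = leftVal A q x r :=
  linearCombination_T _ _

theorem leftOp_op_smul (x : Letter Λ S) (a : A) (v : R →₀ A) :
    leftOp A q x (op a • v) = op a • leftOp A q x v := by
  refine linearCombination_op_smul (fun r b => ?_) a v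
  rcases x with s | e
  · simp only [leftVal, smul_add, op_smul_smul_T]
  · simp only [leftVal, op_smul_smul_T]

/-- The operator of left multiplication by the product of the `T_x`, for `x` running over the
letters of a word. -/
noncomputable def leftProd (ω : List (Letter Λ S)) : Module.End A (R →₀ A) :=
  (ω.map (leftOp A q)).prod

theorem leftProd_cons (x : Letter Λ S) (ω : List (Letter Λ S)) (v : R →₀ A) :
    leftProd A q (x :: ω) v = leftOp A q x (leftProd A q ω v) := by
  rw [leftProd, List.map_cons, List.prod_cons, Module.End.mul_apply, leftProd]

theorem leftProd_op_smul (ω : List (Letter Λ S)) (a : A) (v : R →₀ A) :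
    leftProd A q ω (op a • v) = op a • leftProd A q ω v := by
  induction ω with
  | nil => rfl
  | cons x ω ih => rw [leftProd_cons, leftProd_cons, ih, leftOp_op_smul]

theorem IsAlgebraMul.mul_eq_leftOp {mul : (R →₀ A) →+ (R →₀ A) →+ (R →₀ A)}
    (halg : IsAlgebraMul (T A 1) mul) {x : Letter Λ S}
    (hmul : ∀ r, mul (T A x.val) (T A r) = leftVal A q x r) (y : R →₀ A) :
    mul (T A x.val) y = leftOp A q x y := by
  induction y using induction_T with
  | zero => simp
  | add y y' hy hy' => rw [map_add, map_add, hy, hy']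
  | smul a r =>
    rw [← halg.smul_middle, op_smul_T, halg.smul_mul, hmul, map_smul, leftOp_T]

theorem IsAlgebraMul.mul_leftProd {mul : (R →₀ A) →+ (R →₀ A) →+ (R →₀ A)}
    (halg : IsAlgebraMul (T A 1) mul)
    (hmul : ∀ (x : Letter Λ S) r, mul (T A x.val) (T A r) = leftVal A q x r)
    (ω : List (Letter Λ S)) (y : R →₀ A) :
    mul (leftProd A q ω (T A 1)) y = leftProd A q ω y := by
  induction ω with
  | nil => exact halg.one_mul y
  | cons x ω ih =>
    rw [leftProd_cons, leftProd_cons, ← halg.mul_eq_leftOp A q (hmul x), halg.mul_assoc, ih,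
      halg.mul_eq_leftOp A q (hmul x)]

namespace IsSystem

variable (h : IsSystem Λ S)

/-- The additive map of the free module induced by the inverse map of `R`, `T_r ↦ T_{r⁻¹}`. It will
turn out to be the standard anti-automorphism of the Hecke algebra. -/
noncomputable def reversal : (R →₀ A) ≃ₗ[A] (R →₀ A) :=
  Finsupp.domLCongr
    (Function.Involutive.toPerm h.factorisable.inverse h.factorisable.inverse_inverse)

/-- Conjugation of operators by the reversal, which turns left multiplications into right ones. -/
noncomputable def conjReversal : Module.End A (R →₀ A) ≃+* Module.End A (R →₀ A) :=
  (h.reversal A).conjRingEquiv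

theorem reversal_T (r : R) : h.reversal A (T A r) = T A (h.factorisable.inverse r) :=
  Finsupp.domLCongr_single _ _ _

theorem reversal_reversal (v : R →₀ A) : h.reversal A (h.reversal A v) = v := by
  suffices hcomp : (h.reversal A).toLinearMap ∘ₗ (h.reversal A).toLinearMap = LinearMap.id from
    LinearMap.congr_fun hcomp v
  refine linearMap_ext_T fun r => ?_
  simp only [LinearMap.comp_apply, LinearEquiv.coe_coe, reversal_T,
    h.factorisable.inverse_inverse, LinearMap.id_apply]

theorem conjReversal_apply (f : Module.End A (R →₀ A)) (v : R →₀ A) :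
    h.conjReversal A f v = h.reversal A (f (h.reversal A v)) := by
  rw [conjReversal, LinearEquiv.conjRingEquiv_apply_apply,
    (h.reversal A).symm_apply_eq.2 (h.reversal_reversal A v).symm]

theorem conjReversal_conjReversal (f : Module.End A (R →₀ A)) :
    h.conjReversal A (h.conjReversal A f) = f :=
  LinearMap.ext fun v => by
    rw [conjReversal_apply, conjReversal_apply, reversal_reversal, reversal_reversal]

/-- The operator of right multiplication by `T_x` for a letter `x`. -/
noncomputable def rightOp (x : Letter Λ S) : Module.End A (R →₀ A) :=
  h.conjReversal A (leftOp A q x)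

theorem rightOp_simple_T (t : S) (r : R) : h.rightOp A q (Sum.inl t) (T A r) =
    stayCoeff q (cmp (length Λ S r) (length Λ S (r * (t : Rˣ)))) • T A r +
      moveCoeff q (cmp (length Λ S r) (length Λ S (r * (t : Rˣ)))) • T A (r * (t : Rˣ)) := by
  rw [rightOp, conjReversal_apply, reversal_T, leftOp_T, leftVal, ← h.inverse_mul_simple t.2,
    h.length_inverse, h.length_inverse, map_add, LinearMapClass.map_smul_of_tower,
    LinearMapClass.map_smul_of_tower, reversal_T, reversal_T, h.factorisable.inverse_inverse,
    h.factorisable.inverse_inverse]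

theorem rightOp_idem_T (f : (Λ \ {1} : Set R)) (r : R) : h.rightOp A q (Sum.inr f) (T A r) =
    q ^ (length Λ S r - length Λ S (r * f)) • T A (r * f) := by
  have hf : (f : R) * h.factorisable.inverse r = h.factorisable.inverse (r * f) := by
    rw [h.factorisable.inverse_mul, h.factorisable.inverse_idem (h.idem_of_mem f f.2.1)]
  rw [rightOp, conjReversal_apply, reversal_T, leftOp_T, leftVal, hf, h.length_inverse,
    h.length_inverse, LinearMapClass.map_smul_of_tower, reversal_T, h.factorisable.inverse_inverse]

theorem commute_leftOp_rightOp_simple_simple (s t : S) :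
    Commute (leftOp A q (Sum.inl s : Letter Λ S)) (h.rightOp A q (Sum.inl t)) := by
  refine linearMap_ext_T fun r => ?_
  simp only [Module.End.mul_apply, leftOp_T, leftVal, rightOp_simple_T, map_add,
    LinearMap.map_smul_of_tower]
  by_cases hexc : (s : Rˣ) * r = r * (t : Rˣ)
  · have hsrt : (s : Rˣ) * r * (t : Rˣ) = r := by rw [hexc, h.mul_mul_cancel_right t.2]
    simp only [← hexc, hsrt, h.mul_mul_cancel s.2]
  · simp only [(h.mul_eq_mul_or_cmp_length_eq s.2 t.2 r).resolve_left hexc,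
      (h.mul_eq_mul_or_cmp_length_mul_eq s.2 t.2 r).resolve_left hexc, mul_assoc]
    module

include h in
theorem stayCoeff_mul_add_moveCoeff_mul {s : Rˣ} (hs : s ∈ S) {f : R} (hf : f ∈ Λ) {r : R}
    (hfix : s * (r * f) = r * f) :
    stayCoeff q (cmp (length Λ S r) (length Λ S (s * r))) *
          q ^ (length Λ S r - length Λ S (r * f)) +
        moveCoeff q (cmp (length Λ S r) (length Λ S (s * r))) *
          q ^ (length Λ S (s * r) - length Λ S (r * f)) =
      q * q ^ (length Λ S r - length Λ S (r * f)) := by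
  have hrf := h.length_mul_idem_le hf r
  have hsrf := h.length_mul_idem_le hf (s * r)
  rw [mul_assoc, hfix] at hsrf
  rcases h.length_mul_cases hs r with hup | hdown | hr
  · rw [LT.lt.cmp_eq_lt (by omega), hup, Nat.sub_add_comm hrf, stayCoeff, moveCoeff]
    ring
  · obtain ⟨n, hn⟩ := Nat.exists_eq_add_of_le hsrf
    rw [LT.lt.cmp_eq_gt (by omega), ← hdown, hn, stayCoeff, moveCoeff, Nat.add_sub_cancel_left,
      add_assoc, Nat.add_sub_cancel_left]
    ring
  · rw [hr, cmp_self_eq_eq, stayCoeff, moveCoeff]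
    ring

theorem commute_leftOp_rightOp_simple_idem (s : S) (f : (Λ \ {1} : Set R)) :
    Commute (leftOp A q (Sum.inl s : Letter Λ S)) (h.rightOp A q (Sum.inr f)) := by
  refine linearMap_ext_T fun r => ?_
  simp only [Module.End.mul_apply, leftOp_T, leftVal, rightOp_idem_T, map_add,
    LinearMap.map_smul_of_tower]
  rw [mul_assoc]
  by_cases hfix : (s : Rˣ) * (r * (f : R)) = r * (f : R)
  · rw [hfix, cmp_self_eq_eq, smul_smul, smul_smul, ← add_smul, ← add_smul,
      h.stayCoeff_mul_add_moveCoeff_mul q s.2 f.2.1 hfix, stayCoeff, moveCoeff]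
    module
  · rw [(h.mul_mul_eq_or_cmp_length_eq s.2 f.2.1 r).resolve_left hfix,
      h.length_sub_length_mul_eq s.2 f.2.1 hfix]
    module

theorem commute_leftOp_rightOp_idem_idem (e f : (Λ \ {1} : Set R)) :
    Commute (leftOp A q (Sum.inr e : Letter Λ S)) (h.rightOp A q (Sum.inr f)) := by
  refine linearMap_ext_T fun r => ?_
  simp only [Module.End.mul_apply, leftOp_T, leftVal, rightOp_idem_T,
    LinearMap.map_smul_of_tower]
  have her := h.length_mul_le e.2 r
  have hrf := h.length_mul_idem_le f.2.1 r
  have herf := h.length_mul_le e.2 (r * f)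
  have herf' := h.length_mul_idem_le f.2.1 (e * r)
  rw [mul_assoc] at herf' ⊢
  rw [smul_smul, smul_smul, ← pow_add, ← pow_add]
  congr 2
  omega

theorem commute_leftOp_rightOp (x y : Letter Λ S) :
    Commute (leftOp A q x) (h.rightOp A q y) := by
  rcases x with s | e <;> rcases y with t | f
  · exact h.commute_leftOp_rightOp_simple_simple A q s t
  · exact h.commute_leftOp_rightOp_simple_idem A q s f
  · simpa only [rightOp, conjReversal_conjReversal] using
      ((h.commute_leftOp_rightOp_simple_idem A q t e).map (h.conjReversal A)).symm
  · exact h.commute_leftOp_rightOp_idem_idem A q e f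

include h in
theorem leftProd_T_one {ω : List (Letter Λ S)} (hω : wordLen ω = length Λ S (wordVal ω)) :
    leftProd A q ω (T A 1) = T A (wordVal ω) := by
  induction ω with
  | nil => rfl
  | cons x ω ih =>
    have hle := length_wordVal_le ω
    rw [wordVal_cons] at hω ⊢
    rw [wordLen_cons] at hω
    rcases x with s | e
    · have hsub := h.length_mul_le_add ((s : Rˣ) : R) (wordVal ω)
      rw [h.length_generator s.2] at hsub
      simp only [Letter.val, Letter.len] at hω ⊢
      rw [leftProd_cons, ih (by omega), leftOp_T, leftVal_of_gt (by omega)]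
    · have hdrop := h.length_mul_le e.2 (wordVal ω)
      simp only [Letter.val, Letter.len] at hω ⊢
      rw [leftProd_cons, ih (by omega), leftOp_T, leftVal, Nat.sub_eq_zero_of_le (by omega),
        pow_zero, one_smul]

include h in
theorem leftOp_T_one (x : Letter Λ S) : leftOp A q x (T A 1) = T A x.val := by
  have hval : wordVal [x] = x.val := List.prod_singleton
  have hlen : wordLen [x] = length Λ S x.val := by
    rcases x with s | e
    · exact (h.length_generator s.2).symm
    · exact (length_eq_zero_of_mem e.2.1).symm
  rw [← hval, ← h.leftProd_T_one A q (by rw [hlen, hval]), leftProd_cons]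
  rfl

/-- The operator of left multiplication by `T_r`, computed from a word of minimal length
representing `r`. -/
noncomputable def leftMul (r : R) : Module.End A (R →₀ A) :=
  leftProd A q (h.exists_minimal_word r).choose

theorem leftMul_T_one (r : R) : h.leftMul A q r (T A 1) = T A r := by
  obtain ⟨hval, hlen⟩ := (h.exists_minimal_word r).choose_spec
  rw [leftMul, h.leftProd_T_one A q (by rw [hlen, hval]), hval]

/-- The operator of right multiplication by `T_r`. -/
noncomputable def rightMul (r : R) : Module.End A (R →₀ A) :=
  h.conjReversal A (h.leftMul A q (h.factorisable.inverse r))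

theorem rightMul_T_one (r : R) : h.rightMul A q r (T A 1) = T A r := by
  rw [rightMul, conjReversal_apply, reversal_T, h.factorisable.inverse_idem IsIdempotentElem.one,
    leftMul_T_one, reversal_T, h.factorisable.inverse_inverse]

theorem commute_leftOp_rightMul (x : Letter Λ S) (r : R) :
    Commute (leftOp A q x) (h.rightMul A q r) := by
  rw [rightMul, leftMul, leftProd, map_list_prod, List.map_map]
  refine Commute.list_prod_right _ _ fun f hf => ?_
  obtain ⟨y, -, rfl⟩ := List.mem_map.1 hf
  exact h.commute_leftOp_rightOp A q x y

theorem commute_leftMul_rightMul (r r' : R) :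
    Commute (h.leftMul A q r) (h.rightMul A q r') := by
  refine Commute.list_prod_left _ _ fun f hf => ?_
  obtain ⟨x, -, rfl⟩ := List.mem_map.1 hf
  exact h.commute_leftOp_rightMul A q x r'

/-- The product of the Hecke algebra with parameter `q`. -/
noncomputable def heckeMul : (R →₀ A) →+ (R →₀ A) →+ (R →₀ A) := mulOfLeft (h.leftMul A q)

theorem isAlgebraMul_heckeMul : IsAlgebraMul (T A (1 : R)) (h.heckeMul A q) :=
  isAlgebraMul_mulOfLeft (h.leftMul_T_one A q) (h.rightMul_T_one A q)
    (h.commute_leftMul_rightMul A q) fun _ => leftProd_op_smul A q _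

theorem heckeMul_letter (x : Letter Λ S) (r : R) :
    h.heckeMul A q (T A x.val) (T A r) = leftVal A q x r := by
  have hcomm := LinearMap.congr_fun (h.commute_leftOp_rightMul A q x r).eq (T A 1)
  rw [Module.End.mul_apply, Module.End.mul_apply, h.leftOp_T_one A q, h.rightMul_T_one A q,
    leftOp_T] at hcomm
  rw [hcomm, heckeMul, mulOfLeft_apply_T (h.leftMul_T_one A q) (h.rightMul_T_one A q)
    (h.commute_leftMul_rightMul A q)]

theorem eq_heckeMul {mul : (R →₀ A) →+ (R →₀ A) →+ (R →₀ A)} (halg : IsAlgebraMul (T A 1) mul)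
    (hmul : ∀ (x : Letter Λ S) r, mul (T A x.val) (T A r) = leftVal A q x r) :
    mul = h.heckeMul A q := by
  refine eq_mulOfLeft halg.smul_mul fun r y => ?_
  rw [← h.leftMul_T_one A q]
  exact halg.mul_leftProd A q hmul _ y

include h in
theorem isHeckeMul_iff {mul : (R →₀ A) →+ (R →₀ A) →+ (R →₀ A)} :
    IsHeckeMul Λ S (algebraMap K A q) mul ↔ IsAlgebraMul (T A 1) mul ∧
      ∀ (x : Letter Λ S) r, mul (T A x.val) (T A r) = leftVal A q x r := by
  refine ⟨fun hm => ⟨hm.isAlgebraMul, fun x r => ?_⟩, fun ⟨halg, hmul⟩ => ⟨halg,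
    fun s hs r hr => ?_, fun s hs r hr => ?_, fun s hs r hr => ?_, fun e he r => ?_⟩⟩
  · rcases x with s | e
    · rcases h.length_mul_cases s.2 r with hr | hr | hr
      · rw [leftVal_of_gt hr]
        exact hm.simple_of_gt s s.2 r hr
      · rw [leftVal_of_lt hr]
        exact hm.simple_of_lt s s.2 r hr
      · rw [leftVal_of_mul_eq hr]
        exact hm.simple_of_eq s s.2 r (by rw [hr])
    · rw [leftVal_idem]
      exact hm.idem e e.2 r
  · exact (hmul (Sum.inl ⟨s, hs⟩) r).trans (leftVal_of_gt (s := ⟨s, hs⟩) hr)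
  · exact (hmul (Sum.inl ⟨s, hs⟩) r).trans
      (leftVal_of_mul_eq (s := ⟨s, hs⟩) (h.mul_eq_self_of_length_eq hs hr))
  · exact (hmul (Sum.inl ⟨s, hs⟩) r).trans (leftVal_of_lt (s := ⟨s, hs⟩) hr)
  · exact (hmul (Sum.inr ⟨e, he⟩) r).trans leftVal_idem

include h in
theorem existsUnique_isHeckeMul : ∃! mul, IsHeckeMul Λ S (algebraMap K A q) mul :=
  ⟨h.heckeMul A q,
    (h.isHeckeMul_iff A q).2 ⟨h.isAlgebraMul_heckeMul A q, h.heckeMul_letter A q⟩,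
    fun _ hmul => h.eq_heckeMul A q ((h.isHeckeMul_iff A q).1 hmul).1
      ((h.isHeckeMul_iff A q).1 hmul).2⟩

end IsSystem

end Operators

end RennerCoxeter

theorem mainTheorem3 {R : Type*} [Monoid R] (Λ : Set R) (S : Set Rˣ)
    (h : RennerCoxeter.IsSystem Λ S) :
    (∀ (A : Type*) [Ring A] (q : A), q ∈ Subring.center A →
      ∃! mul : (R →₀ A) →+ (R →₀ A) →+ (R →₀ A), RennerCoxeter.IsHeckeMul Λ S q mul) ∧
    (∃! mul : (R →₀ Polynomial ℤ) →+ (R →₀ Polynomial ℤ) →+ (R →₀ Polynomial ℤ),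
      RennerCoxeter.IsHeckeMul Λ S (Polynomial.X : Polynomial ℤ) mul) :=
  ⟨fun A _ q hq => h.existsUnique_isHeckeMul A (⟨q, hq⟩ : Subring.center A),
    h.existsUnique_isHeckeMul (Polynomial ℤ) (Polynomial.X : Polynomial ℤ)⟩
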